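/- Let $(M_n)_{n\ge 1}$ be a sequence of $2\times 2$ integer matrices that are expanding (all complex eigenvalues have modulus $>1$), and let $(D_n)_{n\ge 1}$ be a sequence of digit sets $$D_n=\left\{\begin{pmatrix}0\\0\end{pmatrix},\begin{pmatrix}\alpha_{n_1}\\ \alpha_{n_2}\end{pmatrix},\begin{pmatrix}\beta_{n_1}\\ \beta_{n_2}\end{pmatrix},\begin{pmatrix}-\alpha_{n_1}-\beta_{n_1}\\ -\alpha_{n_2}-\beta_{n_2}\end{pmatrix}\right\}\subset\mathbb{Z}^2,$$ with $\alpha_{n_1}\beta_{n_2}-\alpha_{n_2}\beta_{n_1}$ odd. Suppose that (i) $|\det(M_n)|>4$ for all $n\ge 1$; (ii) $\sup_{n\ge 1}\|M_n^{-1}\|<1$, where $\|\cdot\|$ is the operator norm with respect to the Euclidean norm; (iii) the collection $\{D_n : n\ge 1\}$ of digit sets is finite. For a finite nonempty set $E\subset\mathbb{R}^2$ let $\delta_E=\frac{1}{\# E}\sum_{e\in E}\delta_e$. Then the finite convolutions $$\mu_n=\delta_{M_1^{-1}D_1}*\delta_{M_1^{-1}M_2^{-1}D_2}*\cdots*\delta_{M_1^{-1}M_2^{-1}\cdots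 M_n^{-1}D_n}$$ converge weakly to a Borel probability measure $\mu=\mu_{\{M_n\},\{D_n\}}$ on $\mathbb{R}^2$ (the Moran measure), and $\mu$ is a spectral measure if and only if $M_n\in GL(2,2\mathbb{Z})$ for all $n\ge 2$. Here $\mu$ is called spectral if there is a countable discrete set $\Lambda\subset\mathbb{R}^2$ such that the functions $x\mapsto e^{2\pi i\langle\lambda,x\rangle}$, $\lambda\in\Lambda$, form an orthonormal basis of $L^2(\mu)$, and $GL(2,2\mathbb{Z})$ denotes the set of $2\times2$ matrices with nonzero determinant all of whose entries are even integers. -/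

import Mathlib

open MeasureTheory Filter Topology
open scoped ENNReal BoundedContinuousFunction

namespace Moran

/-- The Euclidean plane. -/
abbrev Plane : Type := EuclideanSpace ℝ (Fin 2)

/-- An integer matrix viewed as a real matrix. -/
def toReal (M : Matrix (Fin 2) (Fin 2) ℤ) : Matrix (Fin 2) (Fin 2) ℝ :=
  M.map (fun a : ℤ => (a : ℝ))

/-- A matrix is expanding if all its complex eigenvalues have modulus greater than one
(in particular it is then invertible over the reals). -/
def IsExpanding (M : Matrix (Fin 2) (Fin 2) ℤ) : Prop :=
  ∀ z ∈ spectrum ℂ (M.map (fun a : ℤ => (a : ℂ))), 1 < ‖z‖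

/-- `GL(2, 2ℤ)`: nonsingular integer matrices all of whose entries are even. -/
def IsGLTwoEven (M : Matrix (Fin 2) (Fin 2) ℤ) : Prop :=
  M.det ≠ 0 ∧ ∀ i j, (2 : ℤ) ∣ M i j

/-- Digit sets `{0, α, β, -α - β}` in `ℤ²` with `α₁ β₂ - α₂ β₁` odd. -/
def IsDigitSet (D : Finset (Fin 2 → ℤ)) : Prop :=
  ∃ α β : Fin 2 → ℤ, Odd (α 0 * β 1 - α 1 * β 0) ∧ D = {0, α, β, -α - β}

/-- The image in the plane of an integer vector `d` under a real matrix `A`. -/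
noncomputable def applyInt (A : Matrix (Fin 2) (Fin 2) ℝ) (d : Fin 2 → ℤ) : Plane :=
  WithLp.toLp 2 (A.mulVec (fun i => (d i : ℝ)))

/-- The operator norm of a real matrix with respect to the Euclidean norm, as an extended
nonnegative real. -/
noncomputable def opENorm (A : Matrix (Fin 2) (Fin 2) ℝ) : ℝ≥0∞ :=
  ‖Matrix.toEuclideanCLM (n := Fin 2) (𝕜 := ℝ) A‖ₑ

/-- The uniform probability measure `δ_E` on a finite nonempty set `E`. -/
noncomputable def discreteMeasure (E : Finset Plane) : Measure Plane :=
  (E.card : ℝ≥0∞)⁻¹ • ∑ e ∈ E, Measure.dirac e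

/-- The product `M₁⁻¹ M₂⁻¹ ⋯ Mₙ⁻¹` (the matrix `M 0` is not used). -/
noncomputable def invProd (M : ℕ → Matrix (Fin 2) (Fin 2) ℤ) : ℕ → Matrix (Fin 2) (Fin 2) ℝ
  | 0 => 1
  | n + 1 => invProd M n * (toReal (M (n + 1)))⁻¹

open Classical in
/-- The finite convolution `δ_{M₁⁻¹ D₁} ∗ ⋯ ∗ δ_{M₁⁻¹ ⋯ Mₙ⁻¹ Dₙ}`; the empty convolution is the
point mass at the origin. -/
noncomputable def partialMoran (M : ℕ → Matrix (Fin 2) (Fin 2) ℤ)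
    (D : ℕ → Finset (Fin 2 → ℤ)) : ℕ → Measure Plane
  | 0 => Measure.dirac 0
  | n + 1 => Measure.conv (partialMoran M D n)
      (discreteMeasure ((D (n + 1)).image (applyInt (invProd M (n + 1)))))

/-- `μ` is the Moran measure of `(Mₙ, Dₙ)` for `n ≥ 1`: a Borel probability measure that is the
weak limit of the finite convolutions. -/
structure IsMoranMeasure (M : ℕ → Matrix (Fin 2) (Fin 2) ℤ) (D : ℕ → Finset (Fin 2 → ℤ))
    (μ : Measure Plane) : Prop where
  isProbabilityMeasure : IsProbabilityMeasure μ
  tendsto_integral : ∀ f : Plane →ᵇ ℝ,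
    Tendsto (fun n => ∫ x, f x ∂(partialMoran M D n)) atTop (𝓝 (∫ x, f x ∂μ))

/-- `μ` is spectral: there is a countable discrete set `Λ` such that the exponentials
`x ↦ exp (2 π i ⟨l, x⟩)`, `l ∈ Λ`, form an orthonormal basis of `L²(μ)`. -/
def IsSpectral (μ : Measure Plane) : Prop :=
  ∃ Λ : Set Plane, Λ.Countable ∧ DiscreteTopology Λ ∧
    ∃ b : HilbertBasis Λ ℂ (Lp ℂ 2 μ), ∀ l : Λ,
      (b l : Plane → ℂ) =ᵐ[μ]
        fun x => Complex.exp (2 * Real.pi * Complex.I * (inner ℝ (l : Plane) x : ℝ))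

end Moran

/-! The Fourier transform of the Moran measure is the infinite product of the masks `mask (D n)`
evaluated at `freq M n ξ`. Everything rests on two facts about one mask. By `mask_eq_zero` and
`exists_admissible`, the zeros of all masks lie in `(2q)⁻¹ (ℤ² \ 2ℤ²)` for one odd `q`. By
`sum_sq_norm_mask`, the squared moduli at the four translates of a point by half-integer vectors sum
to one.

Even matrices give a spectrum. Transposes of even matrices carry half-integer vectors to integer
ones, so frequencies can be built level by level, each having four children that agree for all
earlier masks. The `4 ^ n` frequencies of level `n` then satisfy Parseval's identity for the `n`-th
partial product (`Admissible.sum_sq_partialProd`), and orthogonality follows. Completeness needs the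
identity to survive the limit, and dominated convergence gives this if the transforms of the tails
are bounded below at the new frequencies. The integer parts of the children are free, so it suffices
that every coset of `ℤ²` contains a point where the tail transform is at least a uniform `ε`
(`TailSystem.exists_uniform_lower_bound`).

This uniform bound is the hard part. If it fails, limits along an ultrafilter produce points on
whose cosets the tail transforms tend to zero. The refinement equation passes such limit zeros to
preimages under the transposed matrices, wherever the mask does not vanish. These preimages become
ever denser; if they never got stuck at mask zeros, one would come close to the origin, where the
transforms are near one (`TailSystem.not_good`). Hence limit zeros lie in `Q⁻¹ ℤ²` with `Q = 2q`,
and the matrices there are constant along the ultrafilter. As `|det| > 4`, each limit zero has two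
incongruent successors, so the number of residues modulo `Q` doubles at every level
(`TailSystem.residues_double`), which is absurd.

Conversely, write a spectral Moran measure as `ν ∗ τ`, with `ν` the `n`-fold convolution. In a
generic direction, the extreme slab of `ν ∗ τ` comes from a single atom of `ν`, of mass `4⁻ⁿ`.
Comparing Parseval for `ν ∗ τ` with Bessel for `τ` on this slab shows that frequencies cannot be
coloured with fewer than `4 ^ n` colours so that any two frequencies whose difference is a zero of
the transform of `ν` get different colours (`IsSpectral.one_le_card_mul`). An odd entry of `M n`
makes one parity at level `n` follow from the other parities, and `4 ^ n / 2` colours suffice, a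
contradiction. -/

namespace Moran

open Complex (I)

/-! ### Exponentials and integer vectors -/

/-- The exponential `e^{2πi⟨ξ, x⟩}`. -/
noncomputable def expo (ξ x : Plane) : ℂ :=
  Complex.exp (2 * Real.pi * Complex.I * (inner ℝ ξ x : ℝ))

/-- An integer vector as a point of the plane. -/
noncomputable def intVec (k : Fin 2 → ℤ) : Plane := WithLp.toLp 2 (fun i => (k i : ℝ))

@[simp] lemma intVec_apply (k : Fin 2 → ℤ) (i : Fin 2) : intVec k i = k i := rfl

lemma intVec_add (k l : Fin 2 → ℤ) : intVec (k + l) = intVec k + intVec l := by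
  ext i; simp

lemma intVec_sub (k l : Fin 2 → ℤ) : intVec (k - l) = intVec k - intVec l := by
  ext i; simp

lemma intVec_neg (k : Fin 2 → ℤ) : intVec (-k) = -intVec k := by
  ext i; simp

@[simp] lemma intVec_zero : intVec 0 = 0 := by
  ext i; simp

lemma intVec_injective : Function.Injective intVec := by
  intro k l h
  funext i
  have := congrArg (fun x : Plane => x i) h
  simpa using this

lemma intVec_smul (n : ℤ) (k : Fin 2 → ℤ) : intVec (n • k) = (n : ℝ) • intVec k := by
  ext i; simp

lemma norm_expo (ξ x : Plane) : ‖expo ξ x‖ = 1 := by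
  have : expo ξ x = Complex.exp (((2 * Real.pi * inner ℝ ξ x : ℝ) : ℂ) * I) := by
    rw [expo]; congr 1; push_cast; ring
  rw [this, Complex.norm_exp_ofReal_mul_I]

lemma expo_add_left (ξ η x : Plane) : expo (ξ + η) x = expo ξ x * expo η x := by
  rw [expo, expo, expo, ← Complex.exp_add, inner_add_left]
  congr 1; push_cast; ring

lemma expo_add_right (ξ x y : Plane) : expo ξ (x + y) = expo ξ x * expo ξ y := by
  rw [expo, expo, expo, ← Complex.exp_add, inner_add_right]
  congr 1; push_cast; ring

@[simp] lemma expo_zero_left (x : Plane) : expo 0 x = 1 := by simp [expo]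

@[simp] lemma expo_zero_right (x : Plane) : expo x 0 = 1 := by simp [expo]

lemma expo_comm (ξ x : Plane) : expo ξ x = expo x ξ := by
  rw [expo, expo, real_inner_comm]

lemma expo_neg_left (ξ x : Plane) : expo (-ξ) x = (expo ξ x)⁻¹ := by
  rw [expo, expo, ← Complex.exp_neg, inner_neg_left]
  congr 1; push_cast; ring

lemma expo_neg_right (ξ x : Plane) : expo ξ (-x) = (expo ξ x)⁻¹ := by
  rw [expo_comm, expo_neg_left, expo_comm]

lemma conj_expo (ξ x : Plane) : (starRingEnd ℂ) (expo ξ x) = expo (-ξ) x := by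
  rw [expo_neg_left, Complex.inv_def, Complex.normSq_eq_norm_sq, norm_expo]; simp

lemma continuous_expo (ξ : Plane) : Continuous (expo ξ) := by
  unfold expo; fun_prop

lemma expo_eq_one_iff (ξ x : Plane) : expo ξ x = 1 ↔ ∃ n : ℤ, inner ℝ ξ x = (n : ℝ) := by
  rw [expo, Complex.exp_eq_one_iff]
  have h : (2 * Real.pi * I : ℂ) ≠ 0 := by simp [Real.pi_ne_zero]
  refine exists_congr fun n => ?_
  rw [mul_comm (2 * Real.pi * I : ℂ), mul_left_inj' h]
  norm_cast

lemma norm_expo_sub_one_le (ξ x : Plane) : ‖expo ξ x - 1‖ ≤ 2 * Real.pi * (‖ξ‖ * ‖x‖) := by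
  have : expo ξ x = Complex.exp (I * ((2 * Real.pi * inner ℝ ξ x : ℝ) : ℂ)) := by
    rw [expo]; congr 1; push_cast; ring
  rw [this]
  refine Real.norm_exp_I_mul_ofReal_sub_one_le.trans ?_
  rw [Real.norm_eq_abs, abs_mul, abs_of_pos (by positivity : (0 : ℝ) < 2 * Real.pi)]
  gcongr
  exact abs_real_inner_le_norm _ _

lemma norm_expo_sub_expo_le (ξ η x : Plane) :
    ‖expo ξ x - expo η x‖ ≤ 2 * Real.pi * (‖ξ - η‖ * ‖x‖) := by
  have : expo ξ x - expo η x = expo η x * (expo (ξ - η) x - 1) := by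
    rw [mul_sub, ← expo_add_left]; simp
  rw [this, norm_mul, norm_expo, one_mul]
  exact norm_expo_sub_one_le _ _

lemma inner_plane (x y : Plane) : inner ℝ x y = x 0 * y 0 + x 1 * y 1 := by
  simp [PiLp.inner_apply, Fin.sum_univ_two]; ring

lemma expo_intVec_intVec (k l : Fin 2 → ℤ) : expo (intVec k) (intVec l) = 1 := by
  rw [expo_eq_one_iff]
  exact ⟨k 0 * l 0 + k 1 * l 1, by rw [inner_plane]; simp⟩

/-! ### Masks of digit sets -/

/-- The mask polynomial `¼ ∑_{d ∈ D} e^{2πi⟨x, d⟩}` of a four-element digit set. -/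
noncomputable def mask (D : Finset (Fin 2 → ℤ)) (x : Plane) : ℂ :=
  4⁻¹ * ∑ d ∈ D, expo x (intVec d)

lemma IsDigitSet.sum_eq {α β : Fin 2 → ℤ} (h : Odd (α 0 * β 1 - α 1 * β 0))
    {G : Type*} [AddCommMonoid G] (f : (Fin 2 → ℤ) → G) :
    ∑ d ∈ ({0, α, β, -α - β} : Finset (Fin 2 → ℤ)), f d = f 0 + (f α + (f β + f (-α - β))) := by
  have hodd : ∀ z : ℤ, α 0 * β 1 - α 1 * β 0 = 2 * z → False := fun z hz => by
    rw [hz] at h; exact (Int.not_odd_iff_even.2 (even_two_mul z)) h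
  have comp : ∀ {u v : Fin 2 → ℤ}, u = v → u 0 = v 0 ∧ u 1 = v 1 := fun e => by simp [e]
  have h1 : (0 : Fin 2 → ℤ) ∉ ({α, β, -α - β} : Finset (Fin 2 → ℤ)) := by
    simp only [Finset.mem_insert, Finset.mem_singleton, not_or]
    refine ⟨fun e => ?_, fun e => ?_, fun e => ?_⟩ <;> obtain ⟨e0, e1⟩ := comp e <;>
      simp only [Pi.zero_apply, Pi.sub_apply, Pi.neg_apply] at e0 e1
    · exact hodd 0 (by rw [← e0, ← e1]; ring)
    · exact hodd 0 (by rw [← e0, ← e1]; ring)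
    · exact hodd 0 (by linear_combination -α 1 * e0 + α 0 * e1)
  have h2 : α ∉ ({β, -α - β} : Finset (Fin 2 → ℤ)) := by
    simp only [Finset.mem_insert, Finset.mem_singleton, not_or]
    refine ⟨fun e => ?_, fun e => ?_⟩ <;> obtain ⟨e0, e1⟩ := comp e <;>
      (try simp only [Pi.sub_apply, Pi.neg_apply] at e0 e1)
    · exact hodd 0 (by rw [e0, e1]; ring)
    · exact hodd 0 (by linear_combination α 0 * e1 - α 1 * e0)
  have h3 : β ∉ ({-α - β} : Finset (Fin 2 → ℤ)) := by
    simp only [Finset.mem_singleton]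
    intro e
    obtain ⟨e0, e1⟩ := comp e
    simp only [Pi.sub_apply, Pi.neg_apply] at e0 e1
    exact hodd 0 (by linear_combination β 1 * e0 - β 0 * e1)
  rw [Finset.sum_insert h1, Finset.sum_insert h2, Finset.sum_insert h3, Finset.sum_singleton]

lemma IsDigitSet.card_eq {D : Finset (Fin 2 → ℤ)} (h : IsDigitSet D) : D.card = 4 := by
  obtain ⟨α, β, hodd, rfl⟩ := h
  rw [Finset.card_eq_sum_ones, IsDigitSet.sum_eq hodd]; rfl

lemma expo_intVec_neg_sub (x : Plane) (α β : Fin 2 → ℤ) :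
    expo x (intVec (-α - β)) = (expo x (intVec α) * expo x (intVec β))⁻¹ := by
  rw [← expo_add_right, ← expo_neg_right, ← intVec_add, ← intVec_neg]
  congr 2; abel

lemma norm_mask_le_one {D : Finset (Fin 2 → ℤ)} (h : IsDigitSet D) (x : Plane) :
    ‖mask D x‖ ≤ 1 := by
  rw [mask, norm_mul]
  have : ‖∑ d ∈ D, expo x (intVec d)‖ ≤ 4 := by
    refine (norm_sum_le _ _).trans ?_
    simp [norm_expo, h.card_eq]
  norm_num
  linarith

lemma mask_zero {D : Finset (Fin 2 → ℤ)} (h : IsDigitSet D) : mask D 0 = 1 := by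
  simp [mask, h.card_eq]

lemma mask_add_intVec (D : Finset (Fin 2 → ℤ)) (x : Plane) (k : Fin 2 → ℤ) :
    mask D (x + intVec k) = mask D x := by
  simp only [mask, expo_add_left, expo_intVec_intVec, mul_one]

lemma continuous_mask (D : Finset (Fin 2 → ℤ)) : Continuous (mask D) := by
  unfold mask expo; fun_prop

/-- Four unimodular numbers `1, x, y, (xy)⁻¹` sum to zero only if they are signs. -/
lemma sq_eq_one_of_sum_eq_zero {x y : ℂ} (hx : ‖x‖ = 1) (hy : ‖y‖ = 1)
    (h : 1 + (x + (y + (x * y)⁻¹)) = 0) : x ^ 2 = 1 ∧ y ^ 2 = 1 ∧ ¬ (x = 1 ∧ y = 1) := by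
  have hx0 : x ≠ 0 := by rintro rfl; simp at hx
  have hy0 : y ≠ 0 := by rintro rfl; simp at hy
  have cx : (starRingEnd ℂ) x = x⁻¹ := by
    rw [Complex.inv_def, Complex.normSq_eq_norm_sq, hx]; simp
  have cy : (starRingEnd ℂ) y = y⁻¹ := by
    rw [Complex.inv_def, Complex.normSq_eq_norm_sq, hy]; simp
  have h' : 1 + (x⁻¹ + (y⁻¹ + (x * y))) = 0 := by
    have := congrArg (starRingEnd ℂ) h
    simpa [cx, cy, mul_comm] using this
  have e1 : x * y * (1 + (x + y)) + 1 = 0 := by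
    have : x * y * (1 + (x + (y + (x * y)⁻¹))) = 0 := by rw [h, mul_zero]
    field_simp at this
    linear_combination this
  have e2 : x * y + (y + x) + (x * y) ^ 2 = 0 := by
    have : x * y * (1 + (x⁻¹ + (y⁻¹ + (x * y)))) = 0 := by rw [h', mul_zero]
    field_simp at this
    linear_combination this
  have nn : ¬ (x = 1 ∧ y = 1) := by
    rintro ⟨rfl, rfl⟩; norm_num at h
  -- Eliminating between the equation and its complex conjugate leaves three cases: `y = -x`, `x * y
  -- = 1` and `x * y = -1`.
  have key : (x + y) * ((x * y - 1) * (x * y + 1)) = 0 := by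
    linear_combination x * y * e1 - e2
  rcases mul_eq_zero.1 key with k | k
  · have hy' : y = -x := by linear_combination k
    subst hy'
    have : x ^ 2 = 1 := by linear_combination -e1
    exact ⟨this, by linear_combination this, nn⟩
  rcases mul_eq_zero.1 k with k | k
  · have s : x + y = -2 := by linear_combination e1 - (1 + x + y) * k
    have : (x + 1) ^ 2 = 0 := by linear_combination x * s - k
    have hx1 : x = -1 := by
      have := pow_eq_zero_iff (two_ne_zero) |>.1 this
      linear_combination this
    have hy1 : y = -1 := by linear_combination s - hx1
    exact ⟨by rw [hx1]; norm_num, by rw [hy1]; norm_num, nn⟩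
  · have s : x + y = 0 := by linear_combination -e1 + (1 + x + y) * k
    have hy' : y = -x := by linear_combination s
    subst hy'
    have : x ^ 2 = 1 := by linear_combination -k
    exact ⟨this, by linear_combination this, nn⟩

lemma exists_two_mul_inner_eq {x z : Plane} (h : expo x z ^ 2 = 1) :
    ∃ n : ℤ, 2 * inner ℝ x z = (n : ℝ) := by
  have : expo ((2 : ℝ) • x) z = 1 := by
    rw [two_smul, expo_add_left, ← sq, h]
  obtain ⟨n, hn⟩ := (expo_eq_one_iff _ _).1 this
  exact ⟨n, by rw [← hn, real_inner_smul_left]⟩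

/-- The zeros of the mask of `{0, α, β, -α - β}` lie in `(2 det)⁻¹ (ℤ² \ 2ℤ²)`. -/
lemma mask_eq_zero {α β : Fin 2 → ℤ} (hodd : Odd (α 0 * β 1 - α 1 * β 0)) {x : Plane}
    (hx : mask {0, α, β, -α - β} x = 0) :
    ∃ w : Fin 2 → ℤ, (∃ i, Odd (w i)) ∧
      ((2 * (α 0 * β 1 - α 1 * β 0) : ℤ) : ℝ) • x = intVec w := by
  rw [mask, IsDigitSet.sum_eq hodd, expo_intVec_neg_sub, intVec_zero, expo_zero_right] at hx
  have hx' := (mul_eq_zero.1 hx).resolve_left (by norm_num)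
  obtain ⟨h1, h2, h3⟩ := sq_eq_one_of_sum_eq_zero (norm_expo _ _) (norm_expo _ _) hx'
  obtain ⟨p, hp⟩ := exists_two_mul_inner_eq h1
  obtain ⟨r, hr⟩ := exists_two_mul_inner_eq h2
  rw [inner_plane] at hp hr
  simp only [intVec_apply] at hp hr
  have hpr : ¬ (Even p ∧ Even r) := by
    rintro ⟨⟨p', rfl⟩, ⟨r', rfl⟩⟩
    push_cast at hp hr
    refine h3 ⟨(expo_eq_one_iff _ _).2 ⟨p', ?_⟩, (expo_eq_one_iff _ _).2 ⟨r', ?_⟩⟩ <;>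
      rw [inner_plane] <;> simp only [intVec_apply] <;> linarith
  -- Cramer's rule for `2⟨x, α⟩ = p`, `2⟨x, β⟩ = r`. Since the determinant is odd, an even solution
  -- would force `p` and `r` to be even.
  refine ⟨![β 1 * p - α 1 * r, α 0 * r - β 0 * p], ?_, ?_⟩
  · by_contra hcon
    push Not at hcon
    have c0 := hcon 0
    have c1 := hcon 1
    simp only [Matrix.cons_val_zero, Matrix.cons_val_one, Int.not_odd_iff_even] at c0 c1
    refine hpr ⟨?_, ?_⟩
    · have : Even ((α 0 * β 1 - α 1 * β 0) * p) := by
        have e : (α 0 * β 1 - α 1 * β 0) * p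
          = α 0 * (β 1 * p - α 1 * r) + α 1 * (α 0 * r - β 0 * p) := by ring
        rw [e]; exact (c0.mul_left _).add (c1.mul_left _)
      exact (Int.even_mul.1 this).resolve_left (Int.not_even_iff_odd.2 hodd)
    · have : Even ((α 0 * β 1 - α 1 * β 0) * r) := by
        have e : (α 0 * β 1 - α 1 * β 0) * r
          = β 0 * (β 1 * p - α 1 * r) + β 1 * (α 0 * r - β 0 * p) := by ring
        rw [e]; exact (c0.mul_left _).add (c1.mul_left _)
      exact (Int.even_mul.1 this).resolve_left (Int.not_even_iff_odd.2 hodd)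
  · ext i
    fin_cases i
    · simp
      linear_combination (β 1 : ℝ) * hp - (α 1 : ℝ) * hr
    · simp
      linear_combination (α 0 : ℝ) * hr - (β 0 : ℝ) * hp

/-- The half-integer vectors `0, (½, 0), (0, ½), (½, ½)`. -/
noncomputable def halfVec (v : ℕ) : Plane :=
  (2⁻¹ : ℝ) • intVec ![(v : ℤ) % 2, (v : ℤ) / 2]

@[simp] lemma halfVec_zero : halfVec 0 = 0 := by
  have : (![((0 : ℕ) : ℤ) % 2, ((0 : ℕ) : ℤ) / 2] : Fin 2 → ℤ) = 0 := by decide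
  rw [halfVec, this]; simp

lemma expo_half (k l : Fin 2 → ℤ) : expo ((2⁻¹ : ℝ) • intVec k) (intVec l) =
    if Even (k 0 * l 0 + k 1 * l 1) then 1 else -1 := by
  have hsq : expo ((2⁻¹ : ℝ) • intVec k) (intVec l) ^ 2 = 1 := by
    rw [sq, ← expo_add_left, ← add_smul]
    norm_num
    exact expo_intVec_intVec k l
  split_ifs with h
  · obtain ⟨m, hm⟩ := h
    refine (expo_eq_one_iff _ _).2 ⟨m, ?_⟩
    have : ((k 0 * l 0 + k 1 * l 1 : ℤ) : ℝ) = m + m := by rw [hm]; push_cast; ring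
    push_cast at this
    rw [real_inner_smul_left, inner_plane]
    simp only [intVec_apply]
    linarith
  · rcases sq_eq_sq_iff_eq_or_eq_neg.1 (hsq.trans (one_pow 2).symm) with h1 | h1
    · exfalso
      obtain ⟨m, hm⟩ := (expo_eq_one_iff _ _).1 h1
      rw [real_inner_smul_left, inner_plane] at hm
      simp only [intVec_apply] at hm
      apply h
      refine ⟨m, ?_⟩
      have : (k 0 * l 0 + k 1 * l 1 : ℝ) = m + m := by linarith
      exact_mod_cast this
    · exact h1

/-- The sign patterns are the four characters of `(ℤ/2)²`, so this is Parseval on that group; two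
rounds of the parallelogram law prove it. -/
lemma sum_signs {X Y Z : ℂ} (hX : ‖X‖ = 1) (hY : ‖Y‖ = 1) (hZ : ‖Z‖ = 1) :
    ‖1 + (X + (Y + Z))‖ ^ 2 + ‖1 + (-X + (Y + -Z))‖ ^ 2 + ‖1 + (X + (-Y + -Z))‖ ^ 2 +
      ‖1 + (-X + (-Y + Z))‖ ^ 2 = 16 := by
  have p1 := parallelogram_law_with_norm ℝ (1 + X) (Y + Z)
  have p2 := parallelogram_law_with_norm ℝ (1 - X) (Y - Z)
  have p3 := parallelogram_law_with_norm ℝ 1 X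
  have p4 := parallelogram_law_with_norm ℝ Y Z
  have e1 : 1 + (X + (Y + Z)) = 1 + X + (Y + Z) := by ring
  have e2 : 1 + (-X + (Y + -Z)) = 1 - X + (Y - Z) := by ring
  have e3 : 1 + (X + (-Y + -Z)) = 1 + X - (Y + Z) := by ring
  have e4 : 1 + (-X + (-Y + Z)) = 1 - X - (Y - Z) := by ring
  rw [e1, e2, e3, e4]
  rw [hX, norm_one] at p3
  rw [hY, hZ] at p4
  nlinarith [p1, p2, p3, p4]

/-- Quadrature mirror identity for the mask. -/
lemma sum_sq_norm_mask {D : Finset (Fin 2 → ℤ)} (h : IsDigitSet D) (x : Plane) :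
    ∑ v ∈ Finset.range 4, ‖mask D (x + halfVec v)‖ ^ 2 = 1 := by
  obtain ⟨α, β, hodd, rfl⟩ := h
  have key : ∀ v, mask {0, α, β, -α - β} (x + halfVec v) = 4⁻¹ * (1 +
      (expo x (intVec α) * expo (halfVec v) (intVec α) +
      (expo x (intVec β) * expo (halfVec v) (intVec β) +
      (expo x (intVec α) * expo x (intVec β))⁻¹ *
        (expo (halfVec v) (intVec α) * expo (halfVec v) (intVec β))⁻¹))) := by
    intro v
    rw [mask, IsDigitSet.sum_eq hodd, expo_intVec_neg_sub, intVec_zero, expo_zero_right,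
      expo_add_left, expo_add_left, ← mul_inv]
    congr 5
    ring
  have hX := norm_expo x (intVec α)
  have hY := norm_expo x (intVec β)
  have hZ : ‖(expo x (intVec α) * expo x (intVec β))⁻¹‖ = 1 := by
    rw [norm_inv, norm_mul, hX, hY]; norm_num
  have hs := sum_signs hX hY hZ
  simp only [Finset.sum_range_succ, Finset.sum_range_zero, key, norm_mul, mul_pow]
  simp only [halfVec, expo_half]
  -- Oddness of the determinant makes `α` and `β` a basis modulo 2. In each admissible parity
  -- pattern the half vectors therefore run through all four sign patterns of `sum_signs`, in some
  -- order.
  rw [← Int.not_even_iff_odd, Int.even_sub, Int.even_mul, Int.even_mul] at hodd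
  generalize expo x (intVec α) = X at *
  generalize expo x (intVec β) = Y at *
  generalize (X * Y)⁻¹ = Z at *
  have two : ((2 : ℕ) : ℤ) % 2 = 0 ∧ ((2 : ℕ) : ℤ) / 2 = 1 ∧ ((3 : ℕ) : ℤ) % 2 = 1 ∧
    ((3 : ℕ) : ℤ) / 2 = 1 ∧ ((1 : ℕ) : ℤ) % 2 = 1 ∧ ((1 : ℕ) : ℤ) / 2 = 0 ∧
    ((0 : ℕ) : ℤ) % 2 = 0 ∧ ((0 : ℕ) : ℤ) / 2 = 0 := by decide
  obtain ⟨q1, q2, q3, q4, q5, q6, q7, q8⟩ := two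
  rw [q1, q2, q3, q4, q5, q6, q7, q8]
  simp only [Matrix.cons_val_zero, Matrix.cons_val_one, zero_mul, one_mul, zero_add, add_zero,
    Even.zero, if_true]
  by_cases a0 : Even (α 0) <;> by_cases a1 : Even (α 1) <;> by_cases b0 : Even (β 0) <;>
    by_cases b1 : Even (β 1) <;>
    simp [a0, a1, b0, b1] at hodd <;>
    simp only [Int.even_add, a0, a1, b0, b1, if_true, if_false, iff_true, iff_false,
      not_true_eq_false, mul_neg, mul_one, neg_neg, inv_one, inv_neg] <;>
    norm_num <;> linarith

end Moran
namespace Moran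

/-! ### Matrices acting on the plane -/

/-- A real matrix as a continuous linear endomorphism of the Euclidean plane. -/
noncomputable def act (A : Matrix (Fin 2) (Fin 2) ℝ) : Plane →L[ℝ] Plane :=
  Matrix.toEuclideanCLM (n := Fin 2) (𝕜 := ℝ) A

lemma act_mul (A B : Matrix (Fin 2) (Fin 2) ℝ) (x : Plane) : act (A * B) x = act A (act B x) := by
  rw [act, map_mul]; rfl

@[simp] lemma act_one (x : Plane) : act 1 x = x := by
  rw [act, map_one]; rfl

lemma act_apply (A : Matrix (Fin 2) (Fin 2) ℝ) (x : Plane) (i : Fin 2) :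
    act A x i = A i 0 * x 0 + A i 1 * x 1 := by
  change (A.mulVec x.ofLp) i = _
  simp [Matrix.mulVec, dotProduct, Fin.sum_univ_two]

lemma inner_act (A : Matrix (Fin 2) (Fin 2) ℝ) (x y : Plane) :
    inner ℝ x (act A y) = inner ℝ (act A.transpose x) y := by
  simp only [inner_plane, act_apply, Matrix.transpose_apply]; ring

lemma expo_act (A : Matrix (Fin 2) (Fin 2) ℝ) (x y : Plane) :
    expo x (act A y) = expo (act A.transpose x) y := by
  rw [expo, expo, inner_act]

lemma norm_act_transpose (A : Matrix (Fin 2) (Fin 2) ℝ) : ‖act A.transpose‖ = ‖act A‖ := by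
  have h : act A.transpose = star (act A) := by
    rw [act, act, ← map_star]; congr 1
  rw [h, ContinuousLinearMap.star_eq_adjoint, LinearIsometryEquiv.norm_map]

lemma act_toReal_intVec (M : Matrix (Fin 2) (Fin 2) ℤ) (k : Fin 2 → ℤ) :
    act (toReal M) (intVec k) = intVec (M.mulVec k) := by
  ext i
  rw [act_apply]
  fin_cases i <;> simp [toReal]

lemma toReal_transpose (M : Matrix (Fin 2) (Fin 2) ℤ) :
    (toReal M).transpose = toReal M.transpose := rfl

lemma det_toReal (M : Matrix (Fin 2) (Fin 2) ℤ) : (toReal M).det = (M.det : ℝ) := by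
  simp [toReal, Matrix.det_fin_two]

/-! ### Admissible sequences -/

/-- The standing assumptions, in the form in which they are inherited by shifted sequences:
`r < 1` bounds the contraction ratios, `C` the digits, and `q` is an odd common multiple of the
determinants of the digit sets, so that all zeros of the masks lie in `(2q)⁻¹ (ℤ² \ 2ℤ²)`. -/
structure Admissible (M : ℕ → Matrix (Fin 2) (Fin 2) ℤ) (D : ℕ → Finset (Fin 2 → ℤ))
    (r C : ℝ) (q : ℕ) : Prop where
  digit : ∀ n ≥ 1, IsDigitSet (D n)
  det : ∀ n ≥ 1, 4 < |(M n).det|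
  norm_le : ∀ n ≥ 1, ‖act (toReal (M n))⁻¹‖ ≤ r
  r_nonneg : 0 ≤ r
  r_lt : r < 1
  digit_le : ∀ n ≥ 1, ∀ d ∈ D n, ‖intVec d‖ ≤ C
  C_nonneg : 0 ≤ C
  q_odd : Odd q
  zeros : ∀ n ≥ 1, ∀ x, mask (D n) x = 0 →
    ∃ w : Fin 2 → ℤ, (∃ i, Odd (w i)) ∧ ((2 * q : ℕ) : ℝ) • x = intVec w
  finite : {E | ∃ n ≥ 1, E = D n}.Finite

lemma opENorm_le_of_iSup {M : ℕ → Matrix (Fin 2) (Fin 2) ℤ}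
    (hnorm : (⨆ n ≥ 1, opENorm (toReal (M n))⁻¹) < 1) {n : ℕ} (hn : 1 ≤ n) :
    ‖act (toReal (M n))⁻¹‖ ≤ (⨆ n ≥ 1, opENorm (toReal (M n))⁻¹).toReal := by
  have h : opENorm (toReal (M n))⁻¹ ≤ ⨆ n ≥ 1, opENorm (toReal (M n))⁻¹ :=
    le_iSup₂_of_le n hn le_rfl
  have h2 := ENNReal.toReal_mono (hnorm.trans ENNReal.one_lt_top).ne h
  simpa [opENorm, act] using h2

/-- As there are finitely many digit sets, `q` can be the product of their `|det|`. Passing to an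
odd multiple of one determinant multiplies the integer vector by an odd number, which keeps an odd
coordinate. -/
lemma exists_admissible {M : ℕ → Matrix (Fin 2) (Fin 2) ℤ} {D : ℕ → Finset (Fin 2 → ℤ)}
    (hdigit : ∀ n ≥ 1, IsDigitSet (D n)) (hdet : ∀ n ≥ 1, 4 < |(M n).det|)
    (hnorm : (⨆ n ≥ 1, opENorm (toReal (M n))⁻¹) < 1)
    (hfin : {E : Finset (Fin 2 → ℤ) | ∃ n ≥ 1, E = D n}.Finite) :
    ∃ r C q, Admissible M D r C q := by
  have h1 : ∀ E : Finset (Fin 2 → ℤ), ∃ q : ℕ, Odd q ∧ (IsDigitSet E → ∀ p : ℕ, Odd p → q ∣ p →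
      ∀ x, mask E x = 0 →
        ∃ w : Fin 2 → ℤ, (∃ i, Odd (w i)) ∧ ((2 * p : ℕ) : ℝ) • x = intVec w) := by
    intro E
    by_cases hE : IsDigitSet E
    · obtain ⟨α, β, hodd, rfl⟩ := hE
      refine ⟨(α 0 * β 1 - α 1 * β 0).natAbs, Int.natAbs_odd.2 hodd, ?_⟩
      rintro - p hp hdvd x hx
      obtain ⟨w, ⟨i, hi⟩, hw⟩ := mask_eq_zero hodd hx
      obtain ⟨c, hc⟩ := Int.natAbs_dvd.1 (Int.natCast_dvd_natCast.2 hdvd)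
      have hcodd : Odd c := by
        have : Odd ((α 0 * β 1 - α 1 * β 0) * c) := by rw [← hc]; exact_mod_cast hp
        exact (Int.odd_mul.1 this).2
      refine ⟨c • w, ⟨i, by simpa using hcodd.mul hi⟩, ?_⟩
      rw [intVec_smul, ← hw, smul_smul]
      congr 1
      have : ((p : ℤ) : ℝ) = (((α 0 * β 1 - α 1 * β 0) * c : ℤ) : ℝ) := by rw [hc]
      push_cast at this ⊢
      rw [this]; ring
    · exact ⟨1, odd_one, fun h => (hE h).elim⟩
  choose q hq hqz using h1
  set F := hfin.toFinset with hF
  have hmem : ∀ n ≥ 1, D n ∈ F := fun n hn => by rw [hF, Set.Finite.mem_toFinset]; exact ⟨n, hn, rfl⟩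
  refine ⟨_, ∑ E ∈ F, ∑ d ∈ E, ‖intVec d‖, ∏ E ∈ F, q E, hdigit, hdet,
    fun n hn => opENorm_le_of_iSup hnorm hn, ENNReal.toReal_nonneg, ?_, ?_, ?_, ?_, ?_, hfin⟩
  · have := (ENNReal.toReal_lt_toReal (hnorm.trans ENNReal.one_lt_top).ne ENNReal.one_ne_top).2 hnorm
    simpa using this
  · intro n hn d hd
    calc ‖intVec d‖ ≤ ∑ d ∈ D n, ‖intVec d‖ :=
          Finset.single_le_sum (f := fun d => ‖intVec d‖) (fun _ _ => norm_nonneg _) hd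
      _ ≤ _ := Finset.single_le_sum (f := fun E : Finset (Fin 2 → ℤ) => ∑ d ∈ E, ‖intVec d‖)
          (fun _ _ => Finset.sum_nonneg fun _ _ => norm_nonneg _) (hmem n hn)
  · exact Finset.sum_nonneg fun _ _ => Finset.sum_nonneg fun _ _ => norm_nonneg _
  · exact Finset.prod_induction _ Odd (fun _ _ => Odd.mul) odd_one fun E _ => hq E
  · intro n hn x hx
    exact hqz (D n) (hdigit n hn) _
      (Finset.prod_induction _ Odd (fun _ _ => Odd.mul) odd_one fun E _ => hq E)
      (Finset.dvd_prod_of_mem q (hmem n hn)) x hx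

/-- The sequence shifted by `N`. -/
def shift {α : Type*} (M : ℕ → α) (N : ℕ) : ℕ → α := fun n => M (n + N)

lemma Admissible.shift {M : ℕ → Matrix (Fin 2) (Fin 2) ℤ} {D : ℕ → Finset (Fin 2 → ℤ)}
    {r C : ℝ} {q : ℕ} (h : Admissible M D r C q) (N : ℕ) :
    Admissible (shift M N) (shift D N) r C q where
  digit n hn := h.digit _ (by omega)
  det n hn := h.det _ (by omega)
  norm_le n hn := h.norm_le _ (by omega)
  r_nonneg := h.r_nonneg
  r_lt := h.r_lt
  digit_le n hn := h.digit_le _ (by omega)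
  C_nonneg := h.C_nonneg
  q_odd := h.q_odd
  zeros n hn := h.zeros _ (by omega)
  finite := h.finite.subset (by rintro E ⟨n, hn, rfl⟩; exact ⟨n + N, by omega, rfl⟩)

section Frequencies

variable {M : ℕ → Matrix (Fin 2) (Fin 2) ℤ} {D : ℕ → Finset (Fin 2 → ℤ)} {r C : ℝ} {q : ℕ}

/-- The transposed inverse `M⁻ᵀ` acting on frequencies. -/
noncomputable def invT (A : Matrix (Fin 2) (Fin 2) ℤ) : Plane →L[ℝ] Plane :=
  act (toReal A)⁻¹.transpose

/-- The transposed matrix `Mᵀ` acting on frequencies. -/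
noncomputable def actT (A : Matrix (Fin 2) (Fin 2) ℤ) : Plane →L[ℝ] Plane :=
  act (toReal A).transpose

lemma invT_actT {A : Matrix (Fin 2) (Fin 2) ℤ} (h : A.det ≠ 0) (x : Plane) :
    invT A (actT A x) = x := by
  rw [invT, actT, ← act_mul, ← Matrix.transpose_mul, Matrix.mul_nonsing_inv, Matrix.transpose_one,
    act_one]
  rw [det_toReal]; exact isUnit_iff_ne_zero.2 (by exact_mod_cast h)

lemma actT_invT {A : Matrix (Fin 2) (Fin 2) ℤ} (h : A.det ≠ 0) (x : Plane) :
    actT A (invT A x) = x := by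
  rw [invT, actT, ← act_mul, ← Matrix.transpose_mul, Matrix.nonsing_inv_mul, Matrix.transpose_one,
    act_one]
  rw [det_toReal]; exact isUnit_iff_ne_zero.2 (by exact_mod_cast h)

lemma actT_intVec (A : Matrix (Fin 2) (Fin 2) ℤ) (k : Fin 2 → ℤ) :
    actT A (intVec k) = intVec (A.transpose.mulVec k) := by
  rw [actT, toReal_transpose, act_toReal_intVec]

/-- The product `Mₙ⁻ᵀ ⋯ M₁⁻ᵀ` acting on frequencies. -/
noncomputable def freq (M : ℕ → Matrix (Fin 2) (Fin 2) ℤ) (n : ℕ) : Plane →L[ℝ] Plane :=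
  act (invProd M n).transpose

@[simp] lemma freq_zero (M : ℕ → Matrix (Fin 2) (Fin 2) ℤ) (x : Plane) : freq M 0 x = x := by
  simp [freq, invProd]

lemma freq_succ (M : ℕ → Matrix (Fin 2) (Fin 2) ℤ) (n : ℕ) (x : Plane) :
    freq M (n + 1) x = invT (M (n + 1)) (freq M n x) := by
  simp only [freq, invProd, Matrix.transpose_mul, act_mul, invT]

lemma freq_add (M : ℕ → Matrix (Fin 2) (Fin 2) ℤ) (N n : ℕ) (x : Plane) :
    freq M (n + N) x = freq (shift M N) n (freq M N x) := by
  induction n with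
  | zero => simp
  | succ n ih => rw [freq_succ, ← ih, Nat.add_right_comm, freq_succ, shift, Nat.add_right_comm]

/-- The product `M₁ᵀ ⋯ Mₙᵀ` acting on frequencies. -/
noncomputable def cofreq (M : ℕ → Matrix (Fin 2) (Fin 2) ℤ) : ℕ → Plane → Plane
  | 0 => id
  | n + 1 => fun x => cofreq M n (actT (M (n + 1)) x)

lemma Admissible.det_ne_zero (h : Admissible M D r C q) {n : ℕ} (hn : 1 ≤ n) :
    (M n).det ≠ 0 := by
  intro e
  have := h.det n hn
  simp [e] at this

lemma Admissible.freq_cofreq (h : Admissible M D r C q) (n : ℕ) (x : Plane) :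
    freq M n (cofreq M n x) = x := by
  induction n generalizing x with
  | zero => simp [cofreq]
  | succ n ih => rw [freq_succ, cofreq, ih, invT_actT (h.det_ne_zero (by omega))]

lemma Admissible.norm_invT (h : Admissible M D r C q) {n : ℕ} (hn : 1 ≤ n) (x : Plane) :
    ‖invT (M n) x‖ ≤ r * ‖x‖ := by
  refine (ContinuousLinearMap.le_opNorm _ _).trans ?_
  rw [invT, norm_act_transpose]
  gcongr
  exact h.norm_le n hn

lemma Admissible.norm_freq (h : Admissible M D r C q) (n : ℕ) (x : Plane) :
    ‖freq M n x‖ ≤ r ^ n * ‖x‖ := by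
  induction n with
  | zero => simp
  | succ n ih =>
    rw [freq_succ]
    calc _ ≤ r * ‖freq M n x‖ := h.norm_invT (by omega) _
      _ ≤ r * (r ^ n * ‖x‖) := by gcongr; exact h.r_nonneg
      _ = _ := by ring

lemma Admissible.norm_act_invProd (h : Admissible M D r C q) (n : ℕ) (x : Plane) :
    ‖act (invProd M n) x‖ ≤ r ^ n * ‖x‖ := by
  refine (ContinuousLinearMap.le_opNorm _ _).trans ?_
  rw [← norm_act_transpose]
  gcongr
  exact ContinuousLinearMap.opNorm_le_bound _ (pow_nonneg h.r_nonneg _) (h.norm_freq n)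

end Frequencies

end Moran
namespace Moran

/-! ### Fourier transforms of measures on the plane -/

/-- The Fourier transform `ξ ↦ ∫ e^{2πi⟨ξ, x⟩} dμ(x)` of a measure. -/
noncomputable def ft (μ : Measure Plane) (ξ : Plane) : ℂ := ∫ x, expo ξ x ∂μ

lemma ft_eq_charFun (μ : Measure Plane) (ξ : Plane) :
    ft μ ξ = charFun μ ((2 * Real.pi) • ξ) := by
  rw [ft, charFun_apply]
  congr 1; ext x
  rw [expo, real_inner_smul_right, real_inner_comm]
  congr 1; push_cast; ring

lemma charFun_eq_ft (μ : Measure Plane) (t : Plane) :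
    charFun μ t = ft μ ((2 * Real.pi)⁻¹ • t) := by
  rw [ft_eq_charFun, smul_smul, mul_inv_cancel₀ (by positivity), one_smul]

lemma integrable_expo (μ : Measure Plane) [IsFiniteMeasure μ] (ξ : Plane) :
    Integrable (expo ξ) μ :=
  (integrable_const (1 : ℝ)).mono (continuous_expo ξ).aestronglyMeasurable
    (Eventually.of_forall fun x => by simp [norm_expo])

lemma measure_ext_of_ft {μ ν : Measure Plane} [IsFiniteMeasure μ] [IsFiniteMeasure ν]
    (h : ∀ ξ, ft μ ξ = ft ν ξ) : μ = ν := by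
  apply Measure.ext_of_charFun
  ext t
  rw [charFun_eq_ft, charFun_eq_ft, h]

lemma ft_conv (μ ν : Measure Plane) [IsFiniteMeasure μ] [IsFiniteMeasure ν] (ξ : Plane) :
    ft (Measure.conv μ ν) ξ = ft μ ξ * ft ν ξ := by
  simp only [ft_eq_charFun, charFun_conv]

lemma ft_dirac (x ξ : Plane) : ft (Measure.dirac x) ξ = expo ξ x := by
  rw [ft, integral_dirac]

lemma ft_zero (μ : Measure Plane) [IsProbabilityMeasure μ] : ft μ 0 = 1 := by
  simp [ft]

lemma ft_map_act (μ : Measure Plane) (A : Matrix (Fin 2) (Fin 2) ℝ) (ξ : Plane) :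
    ft (μ.map (act A)) ξ = ft μ (act A.transpose ξ) := by
  rw [ft, ft, integral_map (act A).continuous.aemeasurable
    (continuous_expo ξ).aestronglyMeasurable]
  simp only [expo_act]

lemma norm_ft_sub_le {μ : Measure Plane} [IsProbabilityMeasure μ] {K : ℝ}
    (h : ∀ᵐ x ∂μ, ‖x‖ ≤ K) (ξ η : Plane) :
    ‖ft μ ξ - ft μ η‖ ≤ 2 * Real.pi * K * ‖ξ - η‖ := by
  rw [ft, ft, ← integral_sub (integrable_expo μ ξ) (integrable_expo μ η)]
  have := norm_integral_le_of_norm_le_const (μ := μ) (f := fun x => expo ξ x - expo η x)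
    (C := 2 * Real.pi * K * ‖ξ - η‖) (by
      filter_upwards [h] with x hx
      refine (norm_expo_sub_expo_le _ _ _).trans ?_
      calc 2 * Real.pi * (‖ξ - η‖ * ‖x‖) ≤ 2 * Real.pi * (‖ξ - η‖ * K) := by gcongr
        _ = _ := by ring)
  simpa using this

lemma ae_norm_le_conv {μ ν : Measure Plane} [SFinite μ] [SFinite ν] {a b : ℝ}
    (hμ : ∀ᵐ x ∂μ, ‖x‖ ≤ a) (hν : ∀ᵐ x ∂ν, ‖x‖ ≤ b) :
    ∀ᵐ x ∂(Measure.conv μ ν), ‖x‖ ≤ a + b := by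
  rw [Measure.conv, ae_map_iff (by fun_prop)
    (measurableSet_le measurable_norm measurable_const)]
  filter_upwards [Measure.quasiMeasurePreserving_fst.ae hμ,
    Measure.quasiMeasurePreserving_snd.ae hν] with x h1 h2
  exact (norm_add_le _ _).trans (add_le_add h1 h2)

/-! ### The finite convolutions -/

section Partial

variable {M : ℕ → Matrix (Fin 2) (Fin 2) ℤ} {D : ℕ → Finset (Fin 2 → ℤ)} {r C : ℝ} {q : ℕ}

lemma Admissible.act_invProd_injective (h : Admissible M D r C q) (n : ℕ) :
    Function.Injective (act (invProd M n)) := by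
  have hdet : (invProd M n).det ≠ 0 := by
    induction n with
    | zero => simp [invProd]
    | succ n ih =>
      rw [invProd, Matrix.det_mul, Matrix.det_nonsing_inv, det_toReal]
      refine mul_ne_zero ih ?_
      rw [Ring.inverse_eq_inv']
      exact inv_ne_zero (by exact_mod_cast h.det_ne_zero (by omega))
  refine Function.LeftInverse.injective (g := act (invProd M n)⁻¹) fun x => ?_
  rw [← act_mul, Matrix.nonsing_inv_mul _ (isUnit_iff_ne_zero.2 hdet), act_one]

open Classical in
lemma Admissible.discreteMeasure_eq (h : Admissible M D r C q) {n : ℕ} (hn : 1 ≤ n) :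
    discreteMeasure ((D n).image (applyInt (invProd M n))) =
      (4 : ℝ≥0∞)⁻¹ • ∑ d ∈ D n, Measure.dirac (act (invProd M n) (intVec d)) := by
  have hinj : Function.Injective (applyInt (invProd M n)) :=
    (h.act_invProd_injective n).comp intVec_injective
  rw [discreteMeasure, Finset.card_image_of_injective _ hinj, (h.digit n hn).card_eq,
    Finset.sum_image fun x _ y _ e => hinj e]
  rfl

open Classical in
lemma Admissible.isProbabilityMeasure_discreteMeasure (h : Admissible M D r C q) {n : ℕ}
    (hn : 1 ≤ n) :
    IsProbabilityMeasure (discreteMeasure ((D n).image (applyInt (invProd M n)))) := by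
  rw [h.discreteMeasure_eq hn]
  constructor
  simp [(h.digit n hn).card_eq]
  exact ENNReal.inv_mul_cancel (by norm_num) (by norm_num)

lemma Admissible.isProbabilityMeasure_partialMoran (h : Admissible M D r C q) (n : ℕ) :
    IsProbabilityMeasure (partialMoran M D n) := by
  induction n with
  | zero => rw [partialMoran]; infer_instance
  | succ n ih =>
    have := h.isProbabilityMeasure_discreteMeasure (n := n + 1) (by omega)
    rw [partialMoran]; infer_instance

open Classical in
lemma Admissible.ft_discreteMeasure (h : Admissible M D r C q) {n : ℕ} (hn : 1 ≤ n) (ξ : Plane) :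
    ft (discreteMeasure ((D n).image (applyInt (invProd M n)))) ξ = mask (D n) (freq M n ξ) := by
  rw [h.discreteMeasure_eq hn, ft, integral_smul_measure, integral_finsetSum_measure]
  · simp only [integral_dirac, mask, expo_act, freq]
    simp
  · intro d _
    exact integrable_expo _ _

/-- The partial products `∏_{1 ≤ k ≤ n} m_{D_k}(M_k⁻ᵀ ⋯ M₁⁻ᵀ ξ)`. -/
noncomputable def partialProd (M : ℕ → Matrix (Fin 2) (Fin 2) ℤ) (D : ℕ → Finset (Fin 2 → ℤ))
    (n : ℕ) (ξ : Plane) : ℂ :=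
  ∏ k ∈ Finset.range n, mask (D (k + 1)) (freq M (k + 1) ξ)

lemma Admissible.ft_partialMoran (h : Admissible M D r C q) (n : ℕ) (ξ : Plane) :
    ft (partialMoran M D n) ξ = partialProd M D n ξ := by
  induction n with
  | zero => simp [partialMoran, ft_dirac, partialProd]
  | succ n ih =>
    have := h.isProbabilityMeasure_discreteMeasure (n := n + 1) (by omega)
    have := h.isProbabilityMeasure_partialMoran n
    rw [partialMoran, ft_conv, ih, h.ft_discreteMeasure (by omega), partialProd, partialProd,
      Finset.prod_range_succ]

lemma partialProd_add (M : ℕ → Matrix (Fin 2) (Fin 2) ℤ) (D : ℕ → Finset (Fin 2 → ℤ))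
    (N n : ℕ) (ξ : Plane) :
    partialProd M D (N + n) ξ =
      partialProd M D N ξ * partialProd (shift M N) (shift D N) n (freq M N ξ) := by
  rw [partialProd, Finset.prod_range_add]
  congr 1
  refine Finset.prod_congr rfl fun k _ => ?_
  rw [show N + k + 1 = (k + 1) + N by omega, freq_add]; rfl

lemma Admissible.norm_partialProd_le_one (h : Admissible M D r C q) (n : ℕ) (ξ : Plane) :
    ‖partialProd M D n ξ‖ ≤ 1 := by
  rw [partialProd, norm_prod]
  exact Finset.prod_le_one (fun _ _ => norm_nonneg _)
    fun k _ => norm_mask_le_one (h.digit _ (by omega)) _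

lemma Admissible.ae_norm_le_discreteMeasure (h : Admissible M D r C q) {n : ℕ} (hn : 1 ≤ n) :
    ∀ᵐ x ∂((4 : ℝ≥0∞)⁻¹ • ∑ d ∈ D n, Measure.dirac (act (invProd M n) (intVec d))),
      ‖x‖ ≤ C * r ^ n := by
  refine Measure.ae_smul_measure ?_ _
  rw [ae_iff, Measure.finsetSum_apply]
  refine Finset.sum_eq_zero fun d hd => ?_
  rw [← ae_iff, ae_dirac_iff (measurableSet_le measurable_norm measurable_const)]
  refine (h.norm_act_invProd n _).trans ?_
  rw [mul_comm]
  exact mul_le_mul_of_nonneg_right (h.digit_le n hn d hd) (pow_nonneg h.r_nonneg _)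

lemma Admissible.ae_norm_le_partialMoran (h : Admissible M D r C q) (n : ℕ) :
    ∀ᵐ x ∂(partialMoran M D n), ‖x‖ ≤ C * (1 - r)⁻¹ := by
  have key : ∀ᵐ x ∂(partialMoran M D n), ‖x‖ ≤ C * ∑ k ∈ Finset.range n, r ^ (k + 1) := by
    induction n with
    | zero => rw [partialMoran, ae_dirac_iff (measurableSet_le measurable_norm measurable_const)]
              simp
    | succ n ih =>
      have := h.isProbabilityMeasure_discreteMeasure (n := n + 1) (by omega)
      have := h.isProbabilityMeasure_partialMoran n
      rw [partialMoran, Finset.sum_range_succ, mul_add]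
      refine ae_norm_le_conv ih ?_
      rw [h.discreteMeasure_eq (by omega)]
      exact h.ae_norm_le_discreteMeasure (by omega)
  filter_upwards [key] with x hx
  refine hx.trans ?_
  gcongr
  · exact h.C_nonneg
  · rw [← tsum_geometric_of_lt_one h.r_nonneg h.r_lt]
    refine le_trans (Finset.sum_le_sum fun k _ => ?_)
      ((summable_geometric_of_lt_one h.r_nonneg h.r_lt).sum_le_tsum (Finset.range n)
        fun k _ => pow_nonneg h.r_nonneg k)
    exact pow_le_pow_of_le_one h.r_nonneg h.r_lt.le (Nat.le_succ k)

/-- The limit of the partial products exists. -/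
lemma Admissible.exists_tendsto_partialProd (h : Admissible M D r C q) (ξ : Plane) :
    ∃ z, Tendsto (fun n => partialProd M D n ξ) atTop (𝓝 z) := by
  refine cauchySeq_tendsto_of_complete
    (cauchySeq_of_le_geometric r (2 * Real.pi * (r * ‖ξ‖) * C) h.r_lt fun n => ?_)
  have hb : ‖mask (D (n + 1)) (freq M (n + 1) ξ) - 1‖ ≤
      2 * Real.pi * (r ^ (n + 1) * ‖ξ‖) * C := by
    have hc := (h.digit (n + 1) (by omega)).card_eq
    have : mask (D (n + 1)) (freq M (n + 1) ξ) - 1 =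
        4⁻¹ * ∑ d ∈ D (n + 1), (expo (freq M (n + 1) ξ) (intVec d) - 1) := by
      rw [mask, Finset.sum_sub_distrib, mul_sub]; simp [hc]
    rw [this, norm_mul]
    have hs : ‖∑ d ∈ D (n + 1), (expo (freq M (n + 1) ξ) (intVec d) - 1)‖ ≤
        ∑ d ∈ D (n + 1), 2 * Real.pi * (r ^ (n + 1) * ‖ξ‖) * C := by
      refine norm_sum_le_of_le _ fun d hd => (norm_expo_sub_one_le _ _).trans ?_
      rw [mul_assoc (2 * Real.pi)]
      gcongr
      · exact mul_nonneg (pow_nonneg h.r_nonneg _) (norm_nonneg _)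
      · exact h.norm_freq _ _
      · exact h.digit_le _ (by omega) d hd
    rw [Finset.sum_const, hc] at hs
    norm_num at hs ⊢
    linarith
  rw [dist_comm, dist_eq_norm, partialProd, Finset.prod_range_succ, ← partialProd, ← mul_sub_one,
    norm_mul]
  calc _ ≤ 1 * (2 * Real.pi * (r ^ (n + 1) * ‖ξ‖) * C) := by
        gcongr
        exact h.norm_partialProd_le_one n ξ
    _ = _ := by ring

end Partial

end Moran
namespace Moran

/-! ### The Moran measure -/

section Limit

variable {M : ℕ → Matrix (Fin 2) (Fin 2) ℤ} {D : ℕ → Finset (Fin 2 → ℤ)} {r C : ℝ} {q : ℕ}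

lemma Admissible.tendsto_partialProd (h : Admissible M D r C q) {μ : Measure Plane}
    (hμ : IsMoranMeasure M D μ) (ξ : Plane) :
    Tendsto (fun n => partialProd M D n ξ) atTop (𝓝 (ft μ ξ)) := by
  have := hμ.isProbabilityMeasure
  have hp := h.isProbabilityMeasure_partialMoran
  let P : ℕ → ProbabilityMeasure Plane := fun n => ⟨partialMoran M D n, hp n⟩
  let μ' : ProbabilityMeasure Plane := ⟨μ, this⟩
  have ht : Tendsto P atTop (𝓝 μ') :=
    ProbabilityMeasure.tendsto_iff_forall_integral_tendsto.2 hμ.tendsto_integral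
  simp only [← h.ft_partialMoran, ft_eq_charFun]
  exact ProbabilityMeasure.tendsto_iff_tendsto_charFun.1 ht ((2 * Real.pi) • ξ)

/-- The convolutions live in a common ball, hence are tight and have a limit along an ultrafilter.
Their characteristic functions converge along the whole sequence, necessarily to that of this limit,
so convergence is full. -/
theorem Admissible.exists_isMoranMeasure (h : Admissible M D r C q) :
    ∃ μ, IsMoranMeasure M D μ := by
  have hp := h.isProbabilityMeasure_partialMoran
  set P : ℕ → ProbabilityMeasure Plane := fun n => ⟨partialMoran M D n, hp n⟩ with hP
  have htight : IsTightMeasureSet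
      {((μ : ProbabilityMeasure Plane) : Measure Plane) | μ ∈ Set.range P} := by
    rw [isTightMeasureSet_iff_exists_isCompact_measure_compl_le]
    refine fun ε hε => ⟨Metric.closedBall 0 (C * (1 - r)⁻¹), isCompact_closedBall _ _, ?_⟩
    rintro _ ⟨_, ⟨n, rfl⟩, rfl⟩
    have h0 : partialMoran M D n (Metric.closedBall 0 (C * (1 - r)⁻¹))ᶜ = 0 := by
      have := h.ae_norm_le_partialMoran n
      rw [ae_iff] at this
      convert this using 2
      ext x; simp
    exact h0.le.trans zero_le
  obtain ⟨μ, -, hμ⟩ := (isCompact_closure_of_isTightMeasureSet htight)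
    |>.ultrafilter_le_nhds ((Filter.hyperfilter ℕ).map P) (by
      rw [le_principal_iff]
      exact mem_map.2 (Eventually.of_forall fun n => subset_closure ⟨n, rfl⟩))
  have hU : Tendsto P (Filter.hyperfilter ℕ) (𝓝 μ) := hμ
  have hint : ∀ t, Tendsto (fun n => charFun (P n : Measure Plane) t) atTop
      (𝓝 (charFun (μ : Measure Plane) t)) := by
    intro t
    obtain ⟨z, hz⟩ := h.exists_tendsto_partialProd ((2 * Real.pi)⁻¹ • t)
    have hz' : Tendsto (fun n => charFun (P n : Measure Plane) t) atTop (𝓝 z) := by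
      simp only [charFun_eq_ft]
      simpa only [hP, ProbabilityMeasure.coe_mk, h.ft_partialMoran] using hz
    have hle : ((Filter.hyperfilter ℕ : Ultrafilter ℕ) : Filter ℕ) ≤ atTop := by
      rw [← Nat.cofinite_eq_atTop]; exact hyperfilter_le_cofinite
    have h1 := (ProbabilityMeasure.tendsto_iff_forall_integral_rclike_tendsto ℂ).1 hU
      (BoundedContinuousFunction.innerProbChar t)
    simp only [← charFun_eq_integral_innerProbChar] at h1
    rwa [tendsto_nhds_unique h1 (hz'.mono_left hle)]
  have := ProbabilityMeasure.tendsto_iff_tendsto_charFun.2 hint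
  exact ⟨μ, inferInstance, fun f =>
    ProbabilityMeasure.tendsto_iff_forall_integral_tendsto.1 this f⟩

lemma Admissible.ae_norm_le (h : Admissible M D r C q) {μ : Measure Plane}
    (hμ : IsMoranMeasure M D μ) : ∀ᵐ x ∂μ, ‖x‖ ≤ C * (1 - r)⁻¹ := by
  have := hμ.isProbabilityMeasure
  set K := C * (1 - r)⁻¹
  let f : Plane →ᵇ ℝ := BoundedContinuousFunction.ofNormedAddCommGroup
    (fun x => min 1 (max 0 (‖x‖ - K))) (by fun_prop) 1 (fun x => by
      rw [Real.norm_eq_abs, abs_of_nonneg (le_min zero_le_one (le_max_left _ _))]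
      exact min_le_left _ _)
  have h0 : ∀ n, ∫ x, f x ∂(partialMoran M D n) = 0 := by
    intro n
    refine integral_eq_zero_of_ae ?_
    filter_upwards [h.ae_norm_le_partialMoran n] with x hx
    change min 1 (max 0 (‖x‖ - K)) = 0
    rw [max_eq_left (by linarith), min_eq_right zero_le_one]
  have h1 : ∫ x, f x ∂μ = 0 := by
    have := hμ.tendsto_integral f
    simp only [h0] at this
    exact tendsto_nhds_unique this tendsto_const_nhds |>.symm ▸ rfl
  have hf0 : 0 ≤ᵐ[μ] f := Eventually.of_forall fun x => le_min zero_le_one (le_max_left _ _)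
  have h2 := (integral_eq_zero_iff_of_nonneg_ae hf0 (f.integrable μ)).1 h1
  filter_upwards [h2] with x hx
  have hx' : min 1 (max 0 (‖x‖ - K)) = 0 := hx
  by_contra hlt
  push Not at hlt
  have : 0 < min 1 (max 0 (‖x‖ - K)) :=
    lt_min one_pos (lt_max_of_lt_right (by linarith))
  linarith

lemma Admissible.ft_eq_partialProd_mul (h : Admissible M D r C q) {μ σ : Measure Plane} {N : ℕ}
    (hμ : IsMoranMeasure M D μ) (hσ : IsMoranMeasure (Moran.shift M N) (Moran.shift D N) σ)
    (ξ : Plane) : ft μ ξ = partialProd M D N ξ * ft σ (freq M N ξ) := by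
  have h1 := (h.tendsto_partialProd hμ ξ).comp (tendsto_add_atTop_nat N)
  have h2 := ((h.shift N).tendsto_partialProd hσ (freq M N ξ)).const_mul (partialProd M D N ξ)
  refine tendsto_nhds_unique h1 (h2.congr fun n => ?_)
  rw [Function.comp, add_comm n N, partialProd_add]

/-- The splitting of the infinite product after `N` factors, read on the level of measures;
necessity is proved from it. -/
lemma Admissible.eq_conv (h : Admissible M D r C q) {μ σ : Measure Plane} {N : ℕ}
    (hμ : IsMoranMeasure M D μ) (hσ : IsMoranMeasure (Moran.shift M N) (Moran.shift D N) σ) :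
    μ = Measure.conv (partialMoran M D N) (σ.map (act (invProd M N))) := by
  have := hμ.isProbabilityMeasure
  have := hσ.isProbabilityMeasure
  have := h.isProbabilityMeasure_partialMoran N
  have : IsProbabilityMeasure (σ.map (act (invProd M N))) :=
    Measure.isProbabilityMeasure_map (act (invProd M N)).continuous.aemeasurable
  refine measure_ext_of_ft fun ξ => ?_
  rw [ft_conv, ft_map_act, h.ft_partialMoran, h.ft_eq_partialProd_mul hμ hσ]
  rfl

end Limit

end Moran
namespace Moran

/-! ### Uniform positivity of the tail transforms -/

lemma exists_intVec_near (y : Plane) : ∃ k : Fin 2 → ℤ, ‖y - intVec k‖ ≤ 2 := by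
  refine ⟨fun i => ⌊y i⌋, ?_⟩
  rw [EuclideanSpace.norm_eq, Fin.sum_univ_two]
  refine Real.sqrt_le_iff.2 ⟨by norm_num, ?_⟩
  have h : ∀ i, ‖(y - intVec fun i => ⌊y i⌋) i‖ ^ 2 ≤ 1 := fun i => by
    have h1 := Int.floor_le (y i)
    have h2 := Int.lt_floor_add_one (y i)
    rw [PiLp.sub_apply, intVec_apply, Real.norm_eq_abs, abs_of_nonneg (by linarith)]
    nlinarith
  linarith [h 0, h 1]

lemma isClosed_range_intVec : IsClosed (Set.range intVec) := by
  have hc := Int.isClosedEmbedding_coe_real.isClosed_range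
  have : Set.range intVec = (fun x : Plane => x 0) ⁻¹' Set.range ((↑) : ℤ → ℝ) ∩
      (fun x : Plane => x 1) ⁻¹' Set.range ((↑) : ℤ → ℝ) := by
    ext x
    constructor
    · rintro ⟨k, rfl⟩
      exact ⟨⟨k 0, rfl⟩, ⟨k 1, rfl⟩⟩
    · rintro ⟨⟨a, ha⟩, ⟨b, hb⟩⟩
      refine ⟨![a, b], ?_⟩
      ext i
      fin_cases i
      · simpa using ha
      · simpa using hb
  rw [this]
  exact (hc.preimage (by fun_prop)).inter (hc.preimage (by fun_prop))

lemma one_le_norm_intVec {k : Fin 2 → ℤ} (hk : k ≠ 0) : 1 ≤ ‖intVec k‖ := by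
  obtain ⟨i, hi⟩ := Function.ne_iff.1 hk
  have h1 : (1 : ℝ) ≤ ‖intVec k i‖ := by
    rw [intVec_apply, Real.norm_eq_abs, ← Int.cast_abs]
    exact_mod_cast Int.one_le_abs hi
  exact h1.trans (PiLp.norm_apply_le _ i)

lemma exists_tendsto_of_bounded (U : Ultrafilter ℕ) {x : ℕ → Plane} {K : ℝ}
    (h : ∀ᶠ i in U, ‖x i‖ ≤ K) : ∃ y, Tendsto x U (𝓝 y) := by
  obtain ⟨y, -, hy⟩ := (isCompact_closedBall (0 : Plane) K).ultrafilter_le_nhds (U.map x) (by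
    rw [le_principal_iff]
    exact (h.mono fun i hi => by simpa using hi : ∀ᶠ i in U, x i ∈ Metric.closedBall 0 K))
  exact ⟨y, hy⟩

lemma exists_eventually_eq_of_finite {α : Type*} (U : Ultrafilter ℕ) {f : ℕ → α} {s : Set α}
    (hs : s.Finite) (h : ∀ᶠ i in U, f i ∈ s) : ∃ a ∈ s, ∀ᶠ i in U, f i = a := by
  have h1 : (⋃ a ∈ s, {i | f i = a}) ∈ U := by
    filter_upwards [h] with i hi
    simpa using hi
  obtain ⟨a, ha, h2⟩ := (Ultrafilter.finite_biUnion_mem_iff hs).1 h1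
  exact ⟨a, ha, h2⟩

/-- If `M⁻ᵀ ℤ²` has no short vectors then `M` has bounded entries. -/
lemma finite_of_no_short_vector {ε : ℝ} (hε : 0 < ε) :
    {A : Matrix (Fin 2) (Fin 2) ℤ | A.det ≠ 0 ∧ (∀ x, ‖invT A x‖ ≤ ‖x‖) ∧
      ∀ k : Fin 2 → ℤ, k ≠ 0 → ε < ‖invT A (intVec k)‖}.Finite := by
  -- `n` bounds the denominators in Dirichlet's approximation and `T` the determinant. They are
  -- chosen so that `1 / (n + 1)` and `n / (ε T)` are both at most `ε / 2`.
  obtain ⟨n, hn⟩ := exists_nat_gt (2 / ε)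
  have hn0 : 0 < n := by
    have : (0 : ℝ) < n := lt_trans (by positivity) hn
    exact_mod_cast this
  obtain ⟨T, hT⟩ := exists_nat_gt (2 * n / ε ^ 2)
  have hT0 : (0 : ℝ) < T := lt_of_le_of_lt (by positivity) hT
  have hfin : {A : Matrix (Fin 2) (Fin 2) ℤ | ∀ i j, A i j ∈ Set.Icc (-T : ℤ) T}.Finite := by
    have := Set.Finite.pi (ι := Fin 2) (t := fun _ => Set.pi Set.univ
      fun _ : Fin 2 => Set.Icc (-T : ℤ) T) fun _ => Set.Finite.pi fun _ => Set.finite_Icc _ _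
    refine this.subset fun A hA => ?_
    exact fun i _ j _ => hA i j
  refine hfin.subset ?_
  rintro A ⟨hdet, hle, hshort⟩
  have hdetR : (toReal A).det ≠ 0 := by rw [det_toReal]; exact_mod_cast hdet
  set W := (toReal A)⁻¹ with hW
  have hAW : toReal A = (A.det : ℝ) • W.adjugate := by
    rw [hW, Matrix.inv_def, ← det_toReal, Matrix.adjugate_smul, Matrix.adjugate_adjugate _ (by simp)]
    simp
    field_simp
    rw [smul_smul, mul_one_div_cancel hdetR, one_smul]
  set v := invT A (intVec ![1, 0]) with hv
  set w := invT A (intVec ![0, 1]) with hw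
  have v0 : v 0 = W 0 0 := by rw [hv, invT, act_apply]; simp [hW]
  have v1 : v 1 = W 0 1 := by rw [hv, invT, act_apply]; simp [hW]
  have w0 : w 0 = W 1 0 := by rw [hw, invT, act_apply]; simp [hW]
  have w1 : w 1 = W 1 1 := by rw [hw, invT, act_apply]; simp [hW]
  have n1 : ‖intVec ![1, 0]‖ = 1 := by rw [EuclideanSpace.norm_eq]; simp
  have n2 : ‖intVec ![0, 1]‖ = 1 := by rw [EuclideanSpace.norm_eq]; simp
  have hv1 : ‖v‖ ≤ 1 := (hle _).trans n1.le
  have hw1 : ‖w‖ ≤ 1 := (hle _).trans n2.le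
  have hvε : ε < ‖v‖ := hshort _ (by decide)
  have hWle : ∀ i j, |W i j| ≤ 1 := by
    intro i j
    fin_cases i <;> fin_cases j
    · change |W 0 0| ≤ 1; rw [← v0]; exact (PiLp.norm_apply_le v 0).trans hv1
    · change |W 0 1| ≤ 1; rw [← v1]; exact (PiLp.norm_apply_le v 1).trans hv1
    · change |W 1 0| ≤ 1; rw [← w0]; exact (PiLp.norm_apply_le w 0).trans hw1
    · change |W 1 1| ≤ 1; rw [← w1]; exact (PiLp.norm_apply_le w 1).trans hw1
  have hdetW : (A.det : ℝ) * (v 0 * w 1 - v 1 * w 0) = 1 := by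
    have h1 : W.det = W 0 0 * W 1 1 - W 0 1 * W 1 0 := Matrix.det_fin_two W
    rw [v0, v1, w0, w1, ← h1, hW, Matrix.det_nonsing_inv, ← det_toReal, Ring.inverse_eq_inv',
      mul_inv_cancel₀ hdetR]
  have hdetT : |(A.det : ℝ)| ≤ T := by
    -- The lattice spanned by `v` and `w` has covolume `1 / |det A|`. If this is tiny, `w` is very
    -- close to the line through `v`, since `v` itself is not short; `e` is the component of `w`
    -- orthogonal to `v`.
    by_contra hcon
    push Not at hcon
    have hvpos : 0 < ‖v‖ := hε.trans hvε
    set t := inner ℝ v w / ‖v‖ ^ 2 with ht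
    set e := w - t • v with he
    have nv : ‖v‖ ^ 2 = v 0 ^ 2 + v 1 ^ 2 := by
      rw [EuclideanSpace.norm_sq_eq, Fin.sum_univ_two]; simp
    have heq : ‖e‖ * ‖v‖ = |v 0 * w 1 - v 1 * w 0| := by
      have ne : ‖e‖ ^ 2 = e 0 ^ 2 + e 1 ^ 2 := by
        rw [EuclideanSpace.norm_sq_eq, Fin.sum_univ_two]; simp
      have htv : t * (v 0 ^ 2 + v 1 ^ 2) = v 0 * w 0 + v 1 * w 1 := by
        rw [ht, ← nv, div_mul_cancel₀ _ (by positivity), inner_plane]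
      have : (‖e‖ * ‖v‖) ^ 2 = (v 0 * w 1 - v 1 * w 0) ^ 2 := by
        rw [mul_pow, ne, nv]
        have e0 : e 0 = w 0 - t * v 0 := by simp [he]
        have e1 : e 1 = w 1 - t * v 1 := by simp [he]
        rw [e0, e1]
        linear_combination (t * (v 0 ^ 2 + v 1 ^ 2) - (v 0 * w 0 + v 1 * w 1)) * htv
      rw [← abs_of_nonneg (mul_nonneg (norm_nonneg e) (norm_nonneg v))]
      exact sq_eq_sq_iff_abs_eq_abs _ _ |>.1 this
    have he_lt : ‖e‖ * (ε * T) ≤ 1 := by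
      have h1 : |(A.det : ℝ)| * (‖e‖ * ‖v‖) = 1 := by rw [heq, ← abs_mul, hdetW, abs_one]
      calc ‖e‖ * (ε * T) = T * (‖e‖ * ε) := by ring
        _ ≤ |(A.det : ℝ)| * (‖e‖ * ‖v‖) := by gcongr
        _ = 1 := h1
    -- With `a / b` close to `t`, the lattice vector `b w - a v = (t b - a) v + b e` is short,
    -- contrary to assumption.
    obtain ⟨a, b, hb0, hbn, hab⟩ := Real.exists_int_int_abs_mul_sub_le t hn0
    have hk : (![-a, b] : Fin 2 → ℤ) ≠ 0 := fun h => by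
      have := congrFun h 1
      simp at this
      omega
    have hlt := hshort _ hk
    have hkv : invT A (intVec ![-a, b]) = (t * b - a) • v + (b : ℝ) • e := by
      have : intVec ![-a, b] = (-a : ℝ) • intVec ![1, 0] + (b : ℝ) • intVec ![0, 1] := by
        ext i; fin_cases i <;> simp
      rw [this, map_add, map_smul, map_smul, ← hv, ← hw, he]
      module
    have hb0' : (0 : ℝ) < b := by exact_mod_cast hb0
    have hbn' : (b : ℝ) ≤ n := by exact_mod_cast hbn
    have hup : ‖invT A (intVec ![-a, b])‖ ≤ 1 / (n + 1) + n * ‖e‖ := by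
      rw [hkv]
      refine (norm_add_le _ _).trans (add_le_add ?_ ?_)
      · rw [norm_smul, Real.norm_eq_abs]
        calc |t * b - a| * ‖v‖ ≤ 1 / (n + 1) * 1 := by
              rw [mul_comm t]
              gcongr
          _ = _ := mul_one _
      · rw [norm_smul, Real.norm_eq_abs, abs_of_pos hb0']
        gcongr
    have hA : 1 / ((n : ℝ) + 1) ≤ ε / 2 := by
      rw [div_le_iff₀ (by positivity)]
      rw [div_lt_iff₀ hε] at hn
      nlinarith
    have hB : n * ‖e‖ ≤ ε / 2 := by
      have h3 : 2 * n < T * ε ^ 2 := by rwa [div_lt_iff₀ (by positivity)] at hT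
      by_contra hc
      push Not at hc
      have : ε / 2 * (ε * T) ≤ n * ‖e‖ * (ε * T) := by gcongr
      have h4 : n * ‖e‖ * (ε * T) ≤ n * 1 := by
        rw [mul_assoc]; gcongr
      nlinarith
    linarith
  intro i j
  rw [Set.mem_Icc, ← abs_le]
  have h1 : |(A i j : ℝ)| ≤ T := by
    have : (A i j : ℝ) = (A.det : ℝ) * W.adjugate i j := by
      have := congrFun (congrFun hAW i) j
      simpa [toReal] using this
    rw [this, abs_mul]
    have hadj : |W.adjugate i j| ≤ 1 := by
      rw [Matrix.adjugate_fin_two]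
      fin_cases i <;> fin_cases j <;> simp [hWle]
    calc _ ≤ (T : ℝ) * 1 := by gcongr
      _ = T := mul_one _
  exact_mod_cast h1

/-! ### Limit zeros of tail systems along an ultrafilter. -/

/-- A system of tail transforms `Ψ n`, linked by the refinement equations
`Ψₙ(ξ) = m_{Eₙ}(Aₙ⁻ᵀ ξ) Ψₙ₊₁(Aₙ⁻ᵀ ξ)` with even matrices `Aₙ`. -/
structure TailSystem (A : ℕ → Matrix (Fin 2) (Fin 2) ℤ) (E : ℕ → Finset (Fin 2 → ℤ))
    (Ψ : ℕ → Plane → ℂ) (r L : ℝ) (Q : ℕ) : Prop where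
  digit : ∀ n, IsDigitSet (E n)
  finite : (Set.range E).Finite
  even : ∀ n i j, (2 : ℤ) ∣ A n i j
  det : ∀ n, 4 < |(A n).det|
  norm_le : ∀ n x, ‖invT (A n) x‖ ≤ r * ‖x‖
  r_nonneg : 0 ≤ r
  r_lt : r < 1
  Q_pos : 0 < Q
  zeros : ∀ n x, mask (E n) x = 0 → (Q : ℝ) • x ∈ Set.range intVec
  refine_eq : ∀ n ξ, Ψ n ξ = mask (E n) (invT (A n) ξ) * Ψ (n + 1) (invT (A n) ξ)
  zero_eq : ∀ n, Ψ n 0 = 1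
  L_nonneg : 0 ≤ L
  lipschitz : ∀ n ξ η, ‖Ψ n ξ - Ψ n η‖ ≤ L * ‖ξ - η‖

namespace TailSystem

variable {A : ℕ → Matrix (Fin 2) (Fin 2) ℤ} {E : ℕ → Finset (Fin 2 → ℤ)}
  {Ψ : ℕ → Plane → ℂ} {r L : ℝ} {Q : ℕ}

/-- Along the ultrafilter `U`, all values of `Ψ (N i + j)` on `x i + ℤ²` tend to zero. -/
def Small (Ψ : ℕ → Plane → ℂ) (U : Ultrafilter ℕ) (N : ℕ → ℕ) (j : ℕ) (x : ℕ → Plane) : Prop :=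
  ∀ η > 0, ∀ᶠ i in U, ∀ k, ‖Ψ (N i + j) (x i + intVec k)‖ < η

/-- The limit zero set at level `j`. -/
def zeroSet (Ψ : ℕ → Plane → ℂ) (U : Ultrafilter ℕ) (N : ℕ → ℕ) (j : ℕ) : Set Plane :=
  {x | Small Ψ U N j fun _ => x}

/-- The limits along `U` of points `xᵢ` with `A (N i + j)ᵀ xᵢ ∈ u + ℤ²` for some `u ∈ T`. -/
def children (A : ℕ → Matrix (Fin 2) (Fin 2) ℤ) (U : Ultrafilter ℕ) (N : ℕ → ℕ) (j : ℕ)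
    (T : Set Plane) : Set Plane :=
  {x | ∃ u ∈ T, ∃ xs : ℕ → Plane, Tendsto xs U (𝓝 x) ∧
    ∀ᶠ i in U, actT (A (N i + j)) (xs i) - u ∈ Set.range intVec}

/-- Every point of `T` in `Q⁻¹ ℤ²` is an accumulation point of `T`. -/
def Good (Q : ℕ) (T : Set Plane) : Prop :=
  ∀ x ∈ T, (Q : ℝ) • x ∈ Set.range intVec → ∀ ε > 0, ∃ x' ∈ T, x' ≠ x ∧ ‖x' - x‖ < ε

/-- `T` is `ρ`-dense. -/
def Covers (T : Set Plane) (ρ : ℝ) : Prop := ∀ y, ∃ x ∈ T, ‖y - x‖ ≤ ρ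

/-- The matrices at level `j` are constant along `U`. -/
def IsConst (A : ℕ → Matrix (Fin 2) (Fin 2) ℤ) (U : Ultrafilter ℕ) (N : ℕ → ℕ) (j : ℕ) : Prop :=
  ∃ B, ∀ᶠ i in U, A (N i + j) = B

lemma det_ne_zero (h : TailSystem A E Ψ r L Q) (n : ℕ) : (A n).det ≠ 0 := by
  intro e
  have := h.det n
  simp [e] at this

lemma norm_le' (h : TailSystem A E Ψ r L Q) (n : ℕ) (x : Plane) : ‖invT (A n) x‖ ≤ ‖x‖ :=
  (h.norm_le n x).trans (mul_le_of_le_one_left (norm_nonneg _) h.r_lt.le)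

variable {U : Ultrafilter ℕ} {N : ℕ → ℕ} {j : ℕ}

lemma Small.congr_of_tendsto (h : TailSystem A E Ψ r L Q) {x y : ℕ → Plane}
    (hx : Small Ψ U N j x) (hxy : Tendsto (fun i => y i - x i) U (𝓝 0)) : Small Ψ U N j y := by
  intro η hη
  -- `L + 1` instead of `L`, because `L` may be zero.
  have h1 : ∀ᶠ i in (U : Filter ℕ), ‖y i - x i‖ < η / 2 / (L + 1) := by
    have := Metric.tendsto_nhds.1 hxy (η / 2 / (L + 1))
      (div_pos (by positivity) (by linarith [h.L_nonneg]))
    simpa using this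
  filter_upwards [h1, hx (η / 2) (by positivity)] with i h2 h3 k
  have h4 := h.lipschitz (N i + j) (y i + intVec k) (x i + intVec k)
  rw [add_sub_add_right_eq_sub] at h4
  have h5 : L * ‖y i - x i‖ ≤ η / 2 := by
    rw [lt_div_iff₀ (by linarith [h.L_nonneg])] at h2
    nlinarith [norm_nonneg (y i - x i)]
  calc ‖Ψ (N i + j) (y i + intVec k)‖
      = ‖(Ψ (N i + j) (y i + intVec k) - Ψ (N i + j) (x i + intVec k))
          + Ψ (N i + j) (x i + intVec k)‖ := by rw [sub_add_cancel]
    _ ≤ _ := norm_add_le _ _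
    _ < η / 2 + η / 2 := add_lt_add_of_le_of_lt (h4.trans h5) (h3 k)
    _ = η := by ring

/-- The refinement equation read backwards: by periodicity the mask is the same on the whole coset
of `x i`, so smallness at `u i` can be divided by it. -/
lemma Small.child (h : TailSystem A E Ψ r L Q) {u x : ℕ → Plane} (hu : Small Ψ U N j u)
    (hx : ∀ᶠ i in U, actT (A (N i + j)) (x i) - u i ∈ Set.range intVec) {κ : ℝ} (hκ : 0 < κ)
    (hm : ∀ᶠ i in U, κ ≤ ‖mask (E (N i + j)) (x i)‖) : Small Ψ U N (j + 1) x := by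
  intro η hη
  filter_upwards [hx, hm, hu (κ * η) (by positivity)] with i ⟨k, hk⟩ h2 h3 l
  have h4 := h3 (k + (A (N i + j)).transpose.mulVec l)
  have h5 : u i + intVec (k + (A (N i + j)).transpose.mulVec l) =
      actT (A (N i + j)) (x i + intVec l) := by
    rw [intVec_add, hk, map_add, actT_intVec]; abel
  rw [h5, h.refine_eq, invT_actT (h.det_ne_zero _), mask_add_intVec, norm_mul] at h4
  have h6 : κ * ‖Ψ (N i + j + 1) (x i + intVec l)‖ < κ * η :=
    (mul_le_mul_of_nonneg_right h2 (norm_nonneg _)).trans_lt h4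
  exact lt_of_mul_lt_mul_left h6 hκ.le

lemma exists_digit_const (h : TailSystem A E Ψ r L Q) (U : Ultrafilter ℕ) (N : ℕ → ℕ) (j : ℕ) :
    ∃ n, ∀ᶠ i in U, E (N i + j) = E n := by
  obtain ⟨a, ⟨n, rfl⟩, ha⟩ := exists_eventually_eq_of_finite U (f := fun i => E (N i + j))
    h.finite (Eventually.of_forall fun i => ⟨_, rfl⟩)
  exact ⟨n, ha⟩

lemma short_of_not_isConst (h : TailSystem A E Ψ r L Q) (hj : ¬ IsConst A U N j) {ε : ℝ}
    (hε : 0 < ε) : ∀ᶠ i in U, ∃ k : Fin 2 → ℤ, k ≠ 0 ∧ ‖invT (A (N i + j)) (intVec k)‖ ≤ ε := by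
  by_contra hcon
  rw [← Ultrafilter.eventually_not] at hcon
  obtain ⟨B, -, hB⟩ := exists_eventually_eq_of_finite U (f := fun i => A (N i + j))
    (finite_of_no_short_vector hε) (by
      filter_upwards [hcon] with i hi
      push Not at hi
      exact ⟨h.det_ne_zero _, h.norm_le' _, hi⟩)
  exact hj ⟨B, hB⟩

/-- Reduce the image of `y` modulo `ℤ²` to a bounded sequence, approximate its limit by a point of
`T`, and pull the error back by the contraction. -/
lemma covers_children (h : TailSystem A E Ψ r L Q) {T : Set Plane} {ρ : ℝ} (hT : Covers T ρ) :
    Covers (children A U N j T) (r * ρ) := by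
  intro y
  choose k hk using fun i => exists_intVec_near (actT (A (N i + j)) y)
  obtain ⟨f, hf⟩ := exists_tendsto_of_bounded U (Eventually.of_forall hk)
  obtain ⟨u, hu, huf⟩ := hT f
  set g : ℕ → Plane := fun i => actT (A (N i + j)) y - intVec (k i) - u with hg
  have hgf : Tendsto g U (𝓝 (f - u)) := hf.sub_const u
  obtain ⟨z, hz⟩ := exists_tendsto_of_bounded U (x := fun i => invT (A (N i + j)) (g i))
    (K := ‖f - u‖ + 1) (by
      filter_upwards [hgf.norm.eventually (gt_mem_nhds (lt_add_one _))] with i hi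
      exact (h.norm_le' _ _).trans hi.le)
  refine ⟨y - z, ⟨u, hu, fun i => y - invT (A (N i + j)) (g i), hz.const_sub y,
    Eventually.of_forall fun i => ⟨k i, ?_⟩⟩, ?_⟩
  · rw [map_sub, actT_invT (h.det_ne_zero _)]; simp only [hg]; abel
  · rw [sub_sub_cancel]
    refine (le_of_tendsto_of_tendsto hz.norm (hgf.norm.const_mul r)
      (Eventually.of_forall fun i => h.norm_le _ _)).trans ?_
    exact mul_le_mul_of_nonneg_left huf h.r_nonneg

/-- For a constant matrix, a child in `Q⁻¹ ℤ²` has its parent there too, and nearby parents lift to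
nearby children. For unbounded matrices, the inverse transposes of `ℤ²` contain arbitrarily short
vectors, and translating by them shows that no child is isolated, whatever `T` is. -/
lemma good_children (h : TailSystem A E Ψ r L Q) {T : Set Plane}
    (hT : Good Q T ∨ ¬ IsConst A U N j) : Good Q (children A U N j T) := by
  rintro x ⟨u, hu, xs, hxs, hint⟩ hQ ε hε
  by_cases hc : IsConst A U N j
  · have hT := hT.resolve_right (not_not.2 hc)
    obtain ⟨B, hB⟩ := hc
    obtain ⟨i₀, hi₀⟩ := hB.exists
    have hdet : B.det ≠ 0 := hi₀ ▸ h.det_ne_zero _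
    have hBx : actT B x - u ∈ Set.range intVec := by
      have ht : Tendsto (fun i => actT B (xs i) - u) U (𝓝 (actT B x - u)) :=
        (((actT B).continuous.tendsto x).comp hxs).sub_const u
      refine isClosed_range_intVec.mem_of_tendsto ht ?_
      filter_upwards [hint, hB] with i h1 h2
      rwa [h2] at h1
    have hQu : (Q : ℝ) • u ∈ Set.range intVec := by
      obtain ⟨w, hw⟩ := hQ
      obtain ⟨k, hk⟩ := hBx
      refine ⟨B.transpose.mulVec w - (Q : ℤ) • k, ?_⟩
      rw [intVec_sub, ← actT_intVec, hw, intVec_smul, hk, map_smul, smul_sub]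
      simp
    obtain ⟨u', hu', hne, hlt⟩ := hT u hu hQu ε hε
    refine ⟨x + invT B (u' - u), ⟨u', hu', fun _ => x + invT B (u' - u), tendsto_const_nhds, ?_⟩,
      ?_, ?_⟩
    · filter_upwards [hB] with i hi
      rw [hi, map_add, actT_invT hdet]
      convert hBx using 1
      abel
    · intro e
      have := congrArg (actT B) (add_eq_left.1 e)
      rw [actT_invT hdet, map_zero, sub_eq_zero] at this
      exact hne this
    · rw [add_sub_cancel_left, ← hi₀]
      exact (h.norm_le' _ _).trans_lt hlt
  · have hm : ∀ᶠ i in U, ∃ k : Fin 2 → ℤ, ε / 4 ≤ ‖invT (A (N i + j)) (intVec k)‖ ∧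
        ‖invT (A (N i + j)) (intVec k)‖ ≤ ε / 2 := by
      filter_upwards [h.short_of_not_isConst hc (ε := ε / 4) (by positivity)] with i ⟨k, hk0, hk⟩
      set z := invT (A (N i + j)) (intVec k) with hz
      have hz0 : 0 < ‖z‖ := by
        rw [norm_pos_iff]
        intro e
        have := congrArg (actT (A (N i + j))) e
        rw [hz, actT_invT (h.det_ne_zero _), map_zero, ← intVec_zero] at this
        exact hk0 (intVec_injective this)
      have hmn := Nat.le_ceil (ε / 4 / ‖z‖)
      have hmx := Nat.ceil_lt_add_one (a := ε / 4 / ‖z‖) (by positivity)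
      -- A multiple of the short vector of length between `ε / 4` and `ε / 2`; the lower bound keeps
      -- the limit translation nonzero.
      set m := ⌈ε / 4 / ‖z‖⌉₊
      refine ⟨(m : ℤ) • k, ?_⟩
      have hn : ‖invT (A (N i + j)) (intVec ((m : ℤ) • k))‖ = m * ‖z‖ := by
        rw [intVec_smul, map_smul, norm_smul, ← hz]; simp
      rw [hn]
      constructor
      · rwa [div_le_iff₀ hz0] at hmn
      · have : (m : ℝ) * ‖z‖ ≤ (ε / 4 / ‖z‖ + 1) * ‖z‖ := by gcongr
        rw [add_mul, div_mul_cancel₀ _ hz0.ne'] at this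
        linarith
    classical
    let k : ℕ → Fin 2 → ℤ := fun i => if hi : _ then (hi : ∃ k : Fin 2 → ℤ,
      ε / 4 ≤ ‖invT (A (N i + j)) (intVec k)‖ ∧ ‖invT (A (N i + j)) (intVec k)‖ ≤ ε / 2).choose
      else 0
    have hk : ∀ᶠ i in U, ε / 4 ≤ ‖invT (A (N i + j)) (intVec (k i))‖ ∧
        ‖invT (A (N i + j)) (intVec (k i))‖ ≤ ε / 2 := by
      filter_upwards [hm] with i hi
      have : k i = hi.choose := dif_pos hi
      rw [this]
      exact hi.choose_spec
    obtain ⟨z, hz⟩ := exists_tendsto_of_bounded U (hk.mono fun i hi => hi.2)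
    have hz1 : ε / 4 ≤ ‖z‖ := ge_of_tendsto hz.norm (hk.mono fun i hi => hi.1)
    have hz2 : ‖z‖ ≤ ε / 2 := le_of_tendsto hz.norm (hk.mono fun i hi => hi.2)
    refine ⟨x + z, ⟨u, hu, fun i => xs i + invT (A (N i + j)) (intVec (k i)), hxs.add hz, ?_⟩,
      ?_, ?_⟩
    · filter_upwards [hint] with i ⟨l, hl⟩
      refine ⟨l + k i, ?_⟩
      rw [intVec_add, hl, map_add, actT_invT (h.det_ne_zero _)]; abel
    · intro e
      rw [add_eq_left.1 e, norm_zero] at hz1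
      linarith
    · rw [add_sub_cancel_left]; linarith

lemma mem_zeroSet_of_tendsto (h : TailSystem A E Ψ r L Q) {x : Plane} {xs : ℕ → Plane}
    (hxs : Tendsto xs U (𝓝 x)) (hs : Small Ψ U N j xs) : x ∈ zeroSet Ψ U N j :=
  hs.congr_of_tendsto h (by simpa using hxs.const_sub x)

lemma isClosed_zeroSet (h : TailSystem A E Ψ r L Q) : IsClosed (zeroSet Ψ U N j) := by
  refine isClosed_of_closure_subset fun x hx => ?_
  intro η hη
  obtain ⟨y, hy, hxy⟩ := Metric.mem_closure_iff.1 hx (η / 2 / (L + 1))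
    (div_pos (by positivity) (by linarith [h.L_nonneg]))
  filter_upwards [hy (η / 2) (by positivity)] with i h3 k
  have h4 := h.lipschitz (N i + j) (x + intVec k) (y + intVec k)
  rw [add_sub_add_right_eq_sub] at h4
  have h5 : L * ‖x - y‖ ≤ η / 2 := by
    rw [dist_eq_norm, lt_div_iff₀ (by linarith [h.L_nonneg])] at hxy
    nlinarith [norm_nonneg (x - y)]
  calc ‖Ψ (N i + j) (x + intVec k)‖
      = ‖(Ψ (N i + j) (x + intVec k) - Ψ (N i + j) (y + intVec k))
          + Ψ (N i + j) (y + intVec k)‖ := by rw [sub_add_cancel]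
    _ ≤ _ := norm_add_le _ _
    _ < η / 2 + η / 2 := add_lt_add_of_le_of_lt (h4.trans h5) (h3 k)
    _ = η := by ring

/-- Children with nonzero mask inherit smallness. A child at a mask zero lies in `Q⁻¹ ℤ²`, hence is
a limit of other children by `good_children`, and the zero set is closed. -/
lemma children_subset (h : TailSystem A E Ψ r L Q) {T : Set Plane}
    (hT : Good Q T ∨ ¬ IsConst A U N j) (hTV : T ⊆ zeroSet Ψ U N j) :
    children A U N j T ⊆ zeroSet Ψ U N (j + 1) := by
  obtain ⟨n, hn⟩ := h.exists_digit_const U N j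
  have key : ∀ x ∈ children A U N j T, mask (E n) x ≠ 0 → x ∈ zeroSet Ψ U N (j + 1) := by
    rintro x ⟨u, hu, xs, hxs, hint⟩ hx
    have hpos : 0 < ‖mask (E n) x‖ := norm_pos_iff.2 hx
    refine h.mem_zeroSet_of_tendsto hxs (Small.child h (hTV hu) hint (half_pos hpos) ?_)
    have ht := (((continuous_mask (E n)).tendsto x).comp hxs).norm
    filter_upwards [hn, ht.eventually (lt_mem_nhds (half_lt_self hpos))] with i h1 h2
    rw [h1]; exact h2.le
  intro x hx
  by_cases hx0 : mask (E n) x = 0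
  · have hQ := h.zeros n x hx0
    have hQ0 : (0 : ℝ) < Q := by exact_mod_cast h.Q_pos
    refine h.isClosed_zeroSet.closure_subset (Metric.mem_closure_iff.2 fun ε hε => ?_)
    -- Distinct points of `Q⁻¹ ℤ²` are at least `Q⁻¹` apart, so `x'` cannot be another zero of the
    -- mask.
    obtain ⟨x', hx', hne, hlt⟩ := h.good_children hT x hx hQ (min ε (Q : ℝ)⁻¹)
      (lt_min hε (by positivity))
    refine ⟨x', key x' hx' fun h0 => ?_, ?_⟩
    · obtain ⟨w, hw⟩ := hQ
      obtain ⟨w', hw'⟩ := h.zeros n x' h0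
      have hww : w' - w ≠ 0 := by
        intro e
        rw [sub_eq_zero] at e
        rw [e, hw] at hw'
        exact hne (smul_right_injective _ hQ0.ne' hw').symm
      have h1 := one_le_norm_intVec hww
      rw [intVec_sub, hw, hw', ← smul_sub, norm_smul, Real.norm_eq_abs, abs_of_pos hQ0] at h1
      have h2 := hlt.trans_le (min_le_right _ _)
      rw [lt_inv_comm₀ (lt_of_le_of_ne (norm_nonneg _) (by
        intro e; rw [← e, mul_zero] at h1; linarith)) hQ0, lt_inv_comm₀ hQ0 (by
          refine lt_of_le_of_ne (norm_nonneg _) ?_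
          intro e; rw [← e, mul_zero] at h1; linarith)] at h2
      rw [← one_div, lt_div_iff₀ hQ0] at h2
      linarith
    · rw [dist_comm, dist_eq_norm]
      exact hlt.trans_le (min_le_left _ _)
  · exact key x hx hx0

/-- Goodness propagates, so children can be taken forever, and their covering radius `r ^ n * ρ`
tends to zero. Some limit zero is then so close to the origin that the Lipschitz bound contradicts
`Ψ n 0 = 1`. -/
lemma not_good (h : TailSystem A E Ψ r L Q) {T : Set Plane} {ρ : ℝ}
    (hTV : T ⊆ zeroSet Ψ U N j) (hT : Good Q T) (hc : Covers T ρ) : False := by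
  have iter : ∀ n, ∃ T', T' ⊆ zeroSet Ψ U N (j + n) ∧ Good Q T' ∧ Covers T' (r ^ n * ρ) := by
    intro n
    induction n with
    | zero => exact ⟨T, hTV, hT, by simpa using hc⟩
    | succ n ih =>
      obtain ⟨T', h1, h2, h3⟩ := ih
      refine ⟨_, h.children_subset (Or.inl h2) h1, h.good_children (Or.inl h2), ?_⟩
      rw [pow_succ', mul_assoc]
      exact h.covers_children h3
  have hlim : Tendsto (fun n => L * (r ^ n * ρ)) atTop (𝓝 0) := by
    have := ((tendsto_pow_atTop_nhds_zero_of_lt_one h.r_nonneg h.r_lt).mul_const ρ).const_mul L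
    simpa using this
  obtain ⟨n, hn⟩ := (hlim.eventually (gt_mem_nhds (show (0 : ℝ) < 1 / 2 by norm_num))).exists
  obtain ⟨T', h1, -, h3⟩ := iter n
  obtain ⟨x, hx, hx0⟩ := h3 0
  obtain ⟨i, hi⟩ := (h1 hx (1 / 2) (by norm_num)).exists
  have h4 := hi 0
  rw [intVec_zero, add_zero] at h4
  have h5 := h.lipschitz (N i + (j + n)) 0 x
  rw [h.zero_eq] at h5
  have h6 : L * ‖0 - x‖ ≤ L * (r ^ n * ρ) := mul_le_mul_of_nonneg_left hx0 h.L_nonneg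
  have h7 := norm_sub_norm_le (1 : ℂ) (Ψ (N i + (j + n)) x)
  rw [norm_one] at h7
  linarith

end TailSystem

end Moran
namespace Moran

/-! ### Rationality of the limit zeros and the doubling of their residues. -/

lemma two_smul_halfVec (v : ℕ) : (2 : ℝ) • halfVec v ∈ Set.range intVec :=
  ⟨_, by rw [halfVec, smul_smul]; norm_num; rfl⟩

/-- The form in which evenness of the entries is used, both for limit zeros and for the construction
of the spectrum. -/
lemma actT_mem_of_even {B : Matrix (Fin 2) (Fin 2) ℤ} (hB : ∀ i j, (2 : ℤ) ∣ B i j) {x : Plane}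
    (hx : (2 : ℝ) • x ∈ Set.range intVec) : actT B x ∈ Set.range intVec := by
  choose c hc using hB
  obtain ⟨w, hw⟩ := hx
  refine ⟨fun i => c 0 i * w 0 + c 1 i * w 1, ?_⟩
  have hx' : x = (2⁻¹ : ℝ) • intVec w := by rw [hw, smul_smul]; norm_num
  rw [hx', map_smul, actT_intVec]
  ext i
  fin_cases i <;> simp [hc] <;> ring

namespace TailSystem

variable {A : ℕ → Matrix (Fin 2) (Fin 2) ℤ} {E : ℕ → Finset (Fin 2 → ℤ)}
  {Ψ : ℕ → Plane → ℂ} {r L : ℝ} {Q : ℕ} {U : Ultrafilter ℕ} {N : ℕ → ℕ} {j : ℕ}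

lemma add_intVec_mem_zeroSet {x : Plane} (hx : x ∈ zeroSet Ψ U N j) (k : Fin 2 → ℤ) :
    x + intVec k ∈ zeroSet Ψ U N j := by
  intro η hη
  filter_upwards [hx η hη] with i hi l
  rw [add_assoc, ← intVec_add]
  exact hi _

lemma covers_coset (u : Plane) : Covers {x | ∃ k, x = u + intVec k} 2 := by
  intro y
  obtain ⟨k, hk⟩ := exists_intVec_near (y - u)
  exact ⟨u + intVec k, ⟨k, rfl⟩, by rwa [← sub_sub]⟩

/-- Otherwise the coset of `x` misses `Q⁻¹ ℤ²` and is vacuously good, against `not_good`. -/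
lemma zeroSet_subset (h : TailSystem A E Ψ r L Q) {x : Plane} (hx : x ∈ zeroSet Ψ U N j) :
    (Q : ℝ) • x ∈ Set.range intVec := by
  by_contra hcon
  refine h.not_good (U := U) (N := N) (j := j) (T := {y | ∃ k, y = x + intVec k}) ?_ ?_ (covers_coset x)
  · rintro y ⟨k, rfl⟩
    exact add_intVec_mem_zeroSet hx k
  · rintro y ⟨k, rfl⟩ ⟨w, hw⟩
    refine (hcon ⟨w - (Q : ℤ) • k, ?_⟩).elim
    rw [intVec_sub, hw, intVec_smul, smul_add]
    simp

/-- Otherwise the children of the coset of `x` are automatically good, and `not_good` applies one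
level further on. -/
lemma isConst_of_mem (h : TailSystem A E Ψ r L Q) {x : Plane} (hx : x ∈ zeroSet Ψ U N j) :
    IsConst A U N j := by
  by_contra hcon
  have hT : {y | ∃ k, y = x + intVec k} ⊆ zeroSet Ψ U N j := by
    rintro y ⟨k, rfl⟩
    exact add_intVec_mem_zeroSet hx k
  exact h.not_good (h.children_subset (Or.inr hcon) hT) (h.good_children (Or.inr hcon))
    (h.covers_children (covers_coset x))

/-- By `sum_sq_norm_mask` the mask is nonzero at one of the four half-integer translates of `y`, and
evenness makes all of them preimages of `x` modulo `ℤ²`. -/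
lemma exists_child (h : TailSystem A E Ψ r L Q) {x y : Plane} (hx : x ∈ zeroSet Ψ U N j)
    {B : Matrix (Fin 2) (Fin 2) ℤ} (hB : ∀ᶠ i in U, A (N i + j) = B)
    (hy : actT B y - x ∈ Set.range intVec) : ∃ v, y + halfVec v ∈ zeroSet Ψ U N (j + 1) := by
  obtain ⟨n, hn⟩ := h.exists_digit_const U N j
  have hex : ∃ v, mask (E n) (y + halfVec v) ≠ 0 := by
    by_contra hcon
    push Not at hcon
    have := sum_sq_norm_mask (h.digit n) y
    simp [hcon] at this
  obtain ⟨v, hv⟩ := hex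
  obtain ⟨i₀, hi₀⟩ := hB.exists
  have hhalf : actT B (halfVec v) ∈ Set.range intVec :=
    actT_mem_of_even (fun a b => hi₀ ▸ h.even _ a b) (two_smul_halfVec v)
  have hpos : 0 < ‖mask (E n) (y + halfVec v)‖ := norm_pos_iff.2 hv
  refine ⟨v, Small.child h (x := fun _ => y + halfVec v) hx ?_ hpos ?_⟩
  · filter_upwards [hB] with i hi
    obtain ⟨a, ha⟩ := hy
    obtain ⟨b, hb⟩ := hhalf
    refine ⟨a + b, ?_⟩
    rw [hi, intVec_add, ha, hb, map_add]; abel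
  · filter_upwards [hn] with i hi
    rw [hi]

/-- Otherwise `2 B⁻ᵀ` is an integer matrix, of determinant `4 / det B`, so `det B` divides 4. This
is where the bound on the determinant enters. -/
lemma exists_not_half {B : Matrix (Fin 2) (Fin 2) ℤ} (hB : 4 < |B.det|) :
    ∃ k, (2 : ℝ) • invT B (intVec k) ∉ Set.range intVec := by
  have hdet : B.det ≠ 0 := by intro e; simp [e] at hB
  by_contra hcon
  push Not at hcon
  obtain ⟨a, ha⟩ := hcon ![1, 0]
  obtain ⟨b, hb⟩ := hcon ![0, 1]
  have key : ∀ (k c : Fin 2 → ℤ), intVec c = (2 : ℝ) • invT B (intVec k) →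
      B.transpose.mulVec c = (2 : ℤ) • k := by
    intro k c hc
    apply intVec_injective
    rw [← actT_intVec, hc, map_smul, actT_invT hdet, intVec_smul]
    norm_num
  have ka := key _ _ ha
  have kb := key _ _ hb
  have a0 := congrFun ka 0
  have a1 := congrFun ka 1
  have b0 := congrFun kb 0
  have b1 := congrFun kb 1
  simp [Matrix.mulVec, dotProduct, Fin.sum_univ_two] at a0 a1 b0 b1
  have hprod : B.det * (a 0 * b 1 - a 1 * b 0) = 4 := by
    rw [Matrix.det_fin_two]
    linear_combination (B 0 1 * b 0 + B 1 1 * b 1) * a0 + 2 * b1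
      - (B 0 1 * a 0 + B 1 1 * a 1) * b0
  have habs : |B.det| * |a 0 * b 1 - a 1 * b 0| = 4 := by rw [← abs_mul, hprod]; norm_num
  have h0 : a 0 * b 1 - a 1 * b 0 ≠ 0 := by
    intro e; rw [e] at hprod; simp at hprod
  have h1 := Int.one_le_abs h0
  nlinarith

/-- Each limit zero has two incongruent children. -/
lemma exists_two_children (h : TailSystem A E Ψ r L Q) {x : Plane} (hx : x ∈ zeroSet Ψ U N j)
    {B : Matrix (Fin 2) (Fin 2) ℤ} (hB : ∀ᶠ i in U, A (N i + j) = B) :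
    ∃ y ∈ zeroSet Ψ U N (j + 1), ∃ z ∈ zeroSet Ψ U N (j + 1),
      actT B y - x ∈ Set.range intVec ∧ actT B z - x ∈ Set.range intVec ∧
      y - z ∉ Set.range intVec := by
  obtain ⟨i₀, hi₀⟩ := hB.exists
  have hdet : B.det ≠ 0 := hi₀ ▸ h.det_ne_zero _
  obtain ⟨k, hk⟩ := exists_not_half (hi₀ ▸ h.det (N i₀ + j) : 4 < |B.det|)
  have hhalf : ∀ v, actT B (halfVec v) ∈ Set.range intVec := fun v =>
    actT_mem_of_even (fun a b => hi₀ ▸ h.even _ a b) (two_smul_halfVec v)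
  -- The two starting points differ by `B⁻ᵀ k`, which is not half-integral; the unknown half-vector
  -- corrections therefore cannot make the children congruent.
  obtain ⟨v, hv⟩ := h.exists_child hx hB (y := invT B (x + intVec k))
    ⟨k, by rw [actT_invT hdet]; abel⟩
  obtain ⟨w, hw⟩ := h.exists_child hx hB (y := invT B x) ⟨0, by rw [actT_invT hdet]; simp⟩
  refine ⟨_, hv, _, hw, ?_, ?_, ?_⟩
  · obtain ⟨a, ha⟩ := hhalf v
    refine ⟨k + a, ?_⟩
    rw [map_add, actT_invT hdet, intVec_add, ha]; abel
  · obtain ⟨a, ha⟩ := hhalf w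
    refine ⟨a, ?_⟩
    rw [map_add, actT_invT hdet, ha]; abel
  · rintro ⟨l, hl⟩
    obtain ⟨a, ha⟩ := two_smul_halfVec v
    obtain ⟨b, hb⟩ := two_smul_halfVec w
    refine hk ⟨(2 : ℤ) • l - a + b, ?_⟩
    rw [intVec_add, intVec_sub, intVec_smul, hl, ha, hb, map_add]
    push_cast
    module

/-- The residues modulo `Q` of the points of `Q ·` (limit zero set). -/
def residues (Ψ : ℕ → Plane → ℂ) (Q : ℕ) (U : Ultrafilter ℕ) (N : ℕ → ℕ) (j : ℕ) :
    Set (Fin 2 → ZMod Q) :=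
  {a | ∃ w : Fin 2 → ℤ, (fun i => (w i : ZMod Q)) = a ∧ (Q : ℝ)⁻¹ • intVec w ∈ zeroSet Ψ U N j}

/-- The transposed matrix acts on residues as a map `φ`. Each old residue has two distinct preimages
under `φ` among the new ones, and fibres over different residues are disjoint. -/
lemma residues_double (h : TailSystem A E Ψ r L Q) (hne : (residues Ψ Q U N j).Nonempty) :
    2 * (residues Ψ Q U N j).ncard ≤ (residues Ψ Q U N (j + 1)).ncard := by
  have hQ0 : (Q : ℝ) ≠ 0 := by exact_mod_cast h.Q_pos.ne'
  have : NeZero Q := ⟨h.Q_pos.ne'⟩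
  obtain ⟨B, hB⟩ : IsConst A U N j := by
    obtain ⟨_, w, _, hw⟩ := hne
    exact h.isConst_of_mem hw
  let φ : (Fin 2 → ZMod Q) → Fin 2 → ZMod Q :=
    fun a i => (B 0 i : ZMod Q) * a 0 + (B 1 i : ZMod Q) * a 1
  have key : ∀ a : residues Ψ Q U N j, ∃ b c : residues Ψ Q U N (j + 1),
      φ b = a ∧ φ c = a ∧ b ≠ c := by
    rintro ⟨_, w, rfl, hw⟩
    obtain ⟨y, hy, z, hz, hyx, hzx, hyz⟩ := h.exists_two_children hw hB
    have lift : ∀ y ∈ zeroSet Ψ U N (j + 1), actT B y - (Q : ℝ)⁻¹ • intVec w ∈ Set.range intVec →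
        ∃ l : Fin 2 → ℤ, y = (Q : ℝ)⁻¹ • intVec l ∧
          φ (fun i => (l i : ZMod Q)) = fun i => (w i : ZMod Q) := by
      rintro y hy ⟨k, hk⟩
      obtain ⟨l, hl⟩ := h.zeroSet_subset hy
      have hyl : y = (Q : ℝ)⁻¹ • intVec l := by rw [hl, smul_smul, inv_mul_cancel₀ hQ0, one_smul]
      refine ⟨l, hyl, ?_⟩
      have e : B.transpose.mulVec l = w + (Q : ℤ) • k := by
        apply intVec_injective
        rw [← actT_intVec, hl, map_smul, intVec_add, intVec_smul, hk, smul_sub, smul_smul]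
        simp [hQ0]
      funext i
      have ei := congrFun e i
      simp [Matrix.mulVec, dotProduct, Fin.sum_univ_two] at ei
      have := congrArg (fun t : ℤ => (t : ZMod Q)) ei
      fin_cases i <;> simpa [φ] using this
    obtain ⟨l, hl, hlφ⟩ := lift y hy hyx
    obtain ⟨m, hm, hmφ⟩ := lift z hz hzx
    refine ⟨⟨_, l, rfl, hl ▸ hy⟩, ⟨_, m, rfl, hm ▸ hz⟩, hlφ, hmφ, fun e => hyz ?_⟩
    have e' := congrArg Subtype.val e
    have hd : ∀ i, ∃ c, l i - m i = (Q : ℤ) * c := by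
      intro i
      have := congrFun e' i
      simp only at this
      rw [← sub_eq_zero, ← Int.cast_sub, ZMod.intCast_zmod_eq_zero_iff_dvd] at this
      exact this
    choose c hc using hd
    refine ⟨c, ?_⟩
    have : intVec l - intVec m = (Q : ℝ) • intVec c := by
      ext i
      have := congrArg (fun t : ℤ => (t : ℝ)) (hc i)
      simpa using this
    rw [hl, hm, ← smul_sub, this, smul_smul, inv_mul_cancel₀ hQ0, one_smul]
  choose b c hb hc hbc using key
  let f : residues Ψ Q U N j ⊕ residues Ψ Q U N j → residues Ψ Q U N (j + 1) := Sum.elim b c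
  have hf : Function.Injective f := by
    rintro (x | x) (y | y) e
    · have : (x : Fin 2 → ZMod Q) = y := by rw [← hb x, ← hb y]; exact congrArg (fun t => φ t.1) e
      rw [Subtype.ext this]
    · have : (x : Fin 2 → ZMod Q) = y := by rw [← hb x, ← hc y]; exact congrArg (fun t => φ t.1) e
      obtain rfl := Subtype.ext this
      exact (hbc x e).elim
    · have : (x : Fin 2 → ZMod Q) = y := by rw [← hc x, ← hb y]; exact congrArg (fun t => φ t.1) e
      obtain rfl := Subtype.ext this
      exact (hbc x e.symm).elim
    · have : (x : Fin 2 → ZMod Q) = y := by rw [← hc x, ← hc y]; exact congrArg (fun t => φ t.1) e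
      rw [Subtype.ext this]
  have := Nat.card_le_card_of_injective f hf
  rw [Nat.card_sum, Nat.card_coe_set_eq, Nat.card_coe_set_eq] at this
  omega

lemma zeroSet_zero_eq_empty (h : TailSystem A E Ψ r L Q) : zeroSet Ψ U N 0 = ∅ := by
  by_contra hne
  have : NeZero Q := ⟨h.Q_pos.ne'⟩
  have hQ0 : (Q : ℝ) ≠ 0 := by exact_mod_cast h.Q_pos.ne'
  obtain ⟨x, hx⟩ := Set.nonempty_iff_ne_empty.2 hne
  have h0 : (residues Ψ Q U N 0).Nonempty := by
    obtain ⟨w, hw⟩ := h.zeroSet_subset hx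
    exact ⟨_, w, rfl, by rwa [hw, smul_smul, inv_mul_cancel₀ hQ0, one_smul]⟩
  have hcard : ∀ j, 2 ^ j ≤ (residues Ψ Q U N j).ncard := by
    intro j
    induction j with
    | zero => simpa [Nat.one_le_iff_ne_zero, Nat.pos_iff_ne_zero] using
        (Set.ncard_pos (Set.toFinite _)).2 h0
    | succ j ih =>
      have hne : (residues Ψ Q U N j).Nonempty :=
        (Set.ncard_pos (Set.toFinite _)).1 (lt_of_lt_of_le (by positivity) ih)
      have := h.residues_double hne
      rw [pow_succ]; omega
  -- There are only `Q ^ 2` residues, fewer than `2 ^ (Q ^ 2)`.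
  have h1 := hcard (Q ^ 2)
  have h2 : (residues Ψ Q U N (Q ^ 2)).ncard ≤ Q ^ 2 := by
    refine (Set.ncard_le_ncard (Set.subset_univ _) (Set.toFinite _)).trans ?_
    rw [Set.ncard_univ, Nat.card_eq_fintype_card]
    simp [ZMod.card]
  exact absurd (h1.trans h2) (not_le.2 Nat.lt_two_pow_self)

/-- Uniform positivity: every coset of `ℤ²` contains a point where `|Ψ n| ≥ ε`. -/
theorem exists_uniform_lower_bound (h : TailSystem A E Ψ r L Q) :
    ∃ ε > 0, ∀ n x, ∃ k, ε ≤ ‖Ψ n (x + intVec k)‖ := by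
  by_contra hcon
  push Not at hcon
  choose N x hx using fun i : ℕ => hcon ((i : ℝ) + 1)⁻¹ (by positivity)
  choose l hl using fun i => exists_intVec_near (x i)
  obtain ⟨y, hy⟩ := exists_tendsto_of_bounded (hyperfilter ℕ) (Eventually.of_forall hl)
  have hle : ((hyperfilter ℕ : Ultrafilter ℕ) : Filter ℕ) ≤ atTop := by
    rw [← Nat.cofinite_eq_atTop]; exact hyperfilter_le_cofinite
  -- Smallness concerns whole cosets, so the points may first be moved into a bounded region.
  have hs : Small Ψ (hyperfilter ℕ) N 0 (fun i => x i - intVec (l i)) := by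
    intro η hη
    have := (tendsto_inv_atTop_nhds_zero_nat (𝕜 := ℝ)).comp (tendsto_add_atTop_nat 1)
    filter_upwards [hle (this.eventually (gt_mem_nhds hη))] with i hi k
    have h1 := hx i (k - l i)
    rw [add_zero, sub_add_eq_add_sub, add_sub_assoc, ← intVec_sub]
    refine h1.trans ?_
    simpa using hi
  have hmem := h.mem_zeroSet_of_tendsto hy hs
  rw [h.zeroSet_zero_eq_empty] at hmem
  exact hmem

end TailSystem

end Moran
namespace Moran

/-! ### Exponentials in `L²(μ)` -/

/-- Removing from `x` its component along `f` leaves the coefficients unchanged, so Bessel's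
inequality forbids the norm to drop. -/
lemma inner_eq_zero_of_parseval {ι F : Type*} [NormedAddCommGroup F] [InnerProductSpace ℂ F]
    {v : ι → F} (hv : Orthonormal ℂ v) {x f : F} (hx : ‖x‖ ^ 2 ≤ ∑' i, ‖inner ℂ (v i) x‖ ^ 2)
    (hf : ∀ i, inner ℂ (v i) f = 0) : inner ℂ f x = 0 := by
  by_contra hne
  have hf0 : f ≠ 0 := by rintro rfl; simp at hne
  have hff : inner ℂ f f ≠ 0 := inner_self_ne_zero.2 hf0
  set c := inner ℂ f x / inner ℂ f f with hc
  set y := x - c • f with hy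
  have hvy : ∀ i, inner ℂ (v i) y = inner ℂ (v i) x := fun i => by
    rw [hy, inner_sub_right, inner_smul_right, hf, mul_zero, sub_zero]
  have hfy : inner ℂ y (c • f) = 0 := by
    rw [← inner_conj_symm, inner_smul_left, hy, inner_sub_right, inner_smul_right, hc,
      div_mul_cancel₀ _ hff, sub_self, mul_zero, map_zero]
  have hle : ‖x‖ ^ 2 ≤ ‖y‖ ^ 2 := by
    refine hx.trans ?_
    simp only [← hvy]
    exact hv.tsum_inner_products_le y
  have hpy := norm_add_sq_eq_norm_sq_add_norm_sq_of_inner_eq_zero y (c • f) hfy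
  rw [hy, sub_add_cancel, ← hy] at hpy
  have hcf : ‖c • f‖ = 0 := by nlinarith [norm_nonneg (c • f)]
  rw [norm_eq_zero, smul_eq_zero] at hcf
  rcases hcf with h | h
  · exact (div_ne_zero hne hff) h
  · exact hf0 h

/-- The positive and negative parts of `g` are densities of two finite measures with equal Fourier
transforms. -/
lemma real_ae_eq_zero_of_integral_expo {μ : Measure Plane} {g : Plane → ℝ} (hg : Integrable g μ)
    (h : ∀ ξ, ∫ x, expo ξ x * (g x : ℂ) ∂μ = 0) : g =ᵐ[μ] 0 := by
  have hm : ∀ f : Plane → ℝ, Integrable f μ → AEMeasurable (fun x => ENNReal.ofReal (f x)) μ :=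
    fun f hf => hf.aestronglyMeasurable.aemeasurable.ennreal_ofReal
  have hfin : ∀ f : Plane → ℝ, Integrable f μ → ∫⁻ x, ENNReal.ofReal (f x) ∂μ ≠ ∞ :=
    fun f hf => ((lintegral_ofReal_le_lintegral_enorm f).trans_lt hf.hasFiniteIntegral).ne
  have hint : ∀ f : Plane → ℝ, Integrable f μ →
      IsFiniteMeasure (μ.withDensity fun x => ENNReal.ofReal (f x)) :=
    fun f hf => isFiniteMeasure_withDensity (hfin f hf)
  have hft : ∀ f : Plane → ℝ, Integrable f μ → ∀ ξ,
      ft (μ.withDensity fun x => ENNReal.ofReal (f x)) ξ = ∫ x, expo ξ x * (max (f x) 0 : ℝ) ∂μ := by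
    intro f hf ξ
    rw [ft, integral_withDensity_eq_integral_toReal_smul₀ (hm f hf)
      (Eventually.of_forall fun x => ENNReal.ofReal_lt_top)]
    congr 1; ext x
    rw [ENNReal.toReal_ofReal', Complex.real_smul, mul_comm]
  have hi : ∀ f : Plane → ℝ, Integrable f μ → ∀ ξ,
      Integrable (fun x => expo ξ x * ((max (f x) 0 : ℝ) : ℂ)) μ := by
    intro f hf ξ
    have := (hf.pos_part).ofReal (𝕜 := ℂ)
    exact this.bdd_mul (c := 1) (continuous_expo ξ).aestronglyMeasurable
      (Eventually.of_forall fun x => (norm_expo ξ x).le)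
  have := hint g hg
  have := hint _ hg.neg
  have heq : (μ.withDensity fun x => ENNReal.ofReal (g x)) =
      μ.withDensity fun x => ENNReal.ofReal ((-g) x) := by
    refine measure_ext_of_ft fun ξ => ?_
    rw [hft g hg, hft _ hg.neg, ← sub_eq_zero, ← integral_sub (hi g hg ξ) (hi _ hg.neg ξ), ← h ξ]
    congr 1; ext x
    rw [← mul_sub, ← Complex.ofReal_sub]
    congr 2
    rcases le_total (g x) 0 with h0 | h0
    · rw [max_eq_right h0, max_eq_left (by simpa using h0)]; simp
    · rw [max_eq_left h0, max_eq_right (by simpa using h0)]; simp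
  have hae := (withDensity_eq_iff (hm g hg) (hm _ hg.neg) (hfin g hg)).1 heq
  filter_upwards [hae] with x hx
  rcases le_total (g x) 0 with h0 | h0
  · rw [ENNReal.ofReal_of_nonpos h0, eq_comm, ENNReal.ofReal_eq_zero] at hx
    exact le_antisymm h0 (by simpa using hx)
  · rw [ENNReal.ofReal_of_nonpos (p := (-g) x) (by simpa using h0), ENNReal.ofReal_eq_zero] at hx
    exact le_antisymm hx h0

lemma ae_eq_zero_of_integral_expo {μ : Measure Plane} {f : Plane → ℂ} (hf : Integrable f μ)
    (h : ∀ ξ, ∫ x, expo ξ x * f x ∂μ = 0) : f =ᵐ[μ] 0 := by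
  have hi : ∀ (g : Plane → ℂ), Integrable g μ → ∀ ξ, Integrable (fun x => expo ξ x * g x) μ :=
    fun g hg ξ => hg.bdd_mul (c := 1) (continuous_expo ξ).aestronglyMeasurable
      (Eventually.of_forall fun x => (norm_expo ξ x).le)
  have hconj : ∀ ξ, ∫ x, expo ξ x * (starRingEnd ℂ) (f x) ∂μ = 0 := by
    intro ξ
    have := congrArg (starRingEnd ℂ) (h (-ξ))
    rw [← integral_conj, map_zero] at this
    simpa only [map_mul, conj_expo, neg_neg] using this
  have hfc : Integrable (fun x => (starRingEnd ℂ) (f x)) μ := by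
    simpa using (Complex.conjLIE.toContinuousLinearEquiv.integrable_comp_iff).2 hf
  have hre : (fun x => (f x).re) =ᵐ[μ] 0 := by
    refine real_ae_eq_zero_of_integral_expo hf.re fun ξ => ?_
    have : ∀ x, expo ξ x * ((f x).re : ℂ) =
        2⁻¹ * (expo ξ x * f x + expo ξ x * (starRingEnd ℂ) (f x)) := fun x => by
      rw [Complex.re_eq_add_conj]; ring
    simp only [this]
    rw [integral_const_mul, integral_add (hi f hf ξ) (hi _ hfc ξ), h, hconj]; simp
  have him : (fun x => (f x).im) =ᵐ[μ] 0 := by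
    refine real_ae_eq_zero_of_integral_expo hf.im fun ξ => ?_
    have : ∀ x, expo ξ x * ((f x).im : ℂ) =
        (2 * Complex.I)⁻¹ * (expo ξ x * f x - expo ξ x * (starRingEnd ℂ) (f x)) := fun x => by
      rw [Complex.im_eq_sub_conj]; ring
    simp only [this]
    rw [integral_const_mul, integral_sub (hi f hf ξ) (hi _ hfc ξ), h, hconj]; simp
  filter_upwards [hre, him] with x h1 h2
  exact Complex.ext h1 h2

section L2

variable (μ : Measure Plane) [IsProbabilityMeasure μ]

lemma memLp_expo (ξ : Plane) : MemLp (expo ξ) 2 μ :=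
  MemLp.of_bound (continuous_expo ξ).aestronglyMeasurable 1
    (Eventually.of_forall fun x => (norm_expo ξ x).le)

/-- The exponential `e_ξ` as an element of `L²(μ)`. -/
noncomputable def expoLp (ξ : Plane) : Lp ℂ 2 μ := (memLp_expo μ ξ).toLp _

lemma coeFn_expoLp (ξ : Plane) : expoLp μ ξ =ᵐ[μ] expo ξ := MemLp.coeFn_toLp _

lemma inner_expoLp_left (ξ : Plane) (f : Lp ℂ 2 μ) :
    inner ℂ (expoLp μ ξ) f = ∫ x, expo (-ξ) x * f x ∂μ := by
  rw [L2.inner_def]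
  refine integral_congr_ae ?_
  filter_upwards [coeFn_expoLp μ ξ] with x hx
  rw [hx, RCLike.inner_apply, conj_expo, mul_comm]

lemma inner_expoLp_expoLp (ξ η : Plane) : inner ℂ (expoLp μ ξ) (expoLp μ η) = ft μ (η - ξ) := by
  rw [inner_expoLp_left, ft]
  refine integral_congr_ae ?_
  filter_upwards [coeFn_expoLp μ η] with x hx
  rw [hx, ← expo_add_left, neg_add_eq_sub]

lemma norm_expoLp (ξ : Plane) : ‖expoLp μ ξ‖ = 1 := by
  have h := inner_self_eq_norm_sq_to_K (𝕜 := ℂ) (expoLp μ ξ)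
  rw [inner_expoLp_expoLp, sub_self, ft_zero] at h
  have h' : ‖expoLp μ ξ‖ ^ 2 = 1 := Complex.ofReal_injective (by
    rw [Complex.ofReal_one, h]; simp)
  exact (pow_eq_one_iff_of_nonneg (norm_nonneg _) two_ne_zero).1 h'

lemma orthonormal_expoLp {ι : Type*} {l : ι → Plane}
    (h : ∀ i j, i ≠ j → ft μ (l j - l i) = 0) : Orthonormal ℂ fun i => expoLp μ (l i) :=
  ⟨fun i => norm_expoLp μ _, fun i j hij => by
    change inner ℂ (expoLp μ (l i)) (expoLp μ (l j)) = 0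
    rw [inner_expoLp_expoLp, h i j hij]⟩

variable {μ}

/-- Criterion for spectrality: orthogonality together with Parseval's identity for exponentials. -/
theorem isSpectral_of_parseval {Λ : Set Plane} (hc : Λ.Countable)
    (ho : ∀ l ∈ Λ, ∀ l' ∈ Λ, l ≠ l' → ft μ (l' - l) = 0)
    (hp : ∀ ξ, 1 ≤ ∑' l : Λ, ‖ft μ (ξ - l)‖ ^ 2) : IsSpectral μ := by
  have hv : Orthonormal ℂ fun l : Λ => expoLp μ (l : Plane) :=
    orthonormal_expoLp μ fun l l' hne => ho l l.2 l' l'.2 fun e => hne (Subtype.ext e)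
  have hcont : ContinuousAt (ft μ) 0 := by
    have : ft μ = fun ξ => charFun μ ((2 * Real.pi) • ξ) := funext (ft_eq_charFun μ)
    rw [this]; fun_prop
  have hspan : (Submodule.span ℂ (Set.range fun l : Λ => expoLp μ (l : Plane)))ᗮ = ⊥ := by
    rw [Submodule.eq_bot_iff]
    intro f hf
    have hf' : ∀ l : Λ, inner ℂ (expoLp μ (l : Plane)) f = 0 := fun l =>
      (Submodule.mem_orthogonal _ _).1 hf _ (Submodule.subset_span ⟨l, rfl⟩)
    have hξ : ∀ ξ, inner ℂ (expoLp μ ξ) f = 0 := by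
      intro ξ
      rw [← inner_conj_symm, inner_eq_zero_of_parseval hv (x := expoLp μ ξ) ?_ hf', map_zero]
      simp only [inner_expoLp_expoLp]
      rw [norm_expoLp, one_pow]
      exact hp ξ
    rw [Lp.eq_zero_iff_ae_eq_zero]
    refine ae_eq_zero_of_integral_expo ((Lp.memLp f).integrable one_le_two) fun ξ => ?_
    rw [← neg_neg ξ, ← inner_expoLp_left, hξ]
  refine ⟨Λ, hc, ?_, HilbertBasis.mkOfOrthogonalEqBot hv hspan, fun l => ?_⟩
  -- Discreteness: differences of distinct frequencies are zeros of `ft μ`, which has none near the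
  -- origin.
  · have hev : ∀ᶠ ξ in 𝓝 (0 : Plane), ft μ ξ ≠ 0 :=
      hcont.eventually_ne (by rw [ft_zero]; exact one_ne_zero)
    obtain ⟨δ, hδ, hball⟩ := Metric.eventually_nhds_iff.1 hev
    refine DiscreteTopology.of_forall_le_dist hδ fun l l' hne => ?_
    by_contra hlt
    push Not at hlt
    refine hball (y := (l' : Plane) - l) ?_ (ho l l.2 l' l'.2 fun e => hne (Subtype.ext e))
    rwa [dist_zero_right, ← dist_eq_norm, dist_comm]
  · rw [HilbertBasis.coe_mkOfOrthogonalEqBot]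
    exact coeFn_expoLp μ _

/-- A spectral measure has orthogonal exponentials satisfying Parseval's identity. -/
lemma IsSpectral.exists_parseval (h : IsSpectral μ) : ∃ Λ : Set Plane,
    (∀ l ∈ Λ, ∀ l' ∈ Λ, l ≠ l' → ft μ (l' - l) = 0) ∧
    ∀ f : Lp ℂ 2 μ, HasSum (fun l : Λ => ‖inner ℂ (expoLp μ l) f‖ ^ 2) (‖f‖ ^ 2) := by
  obtain ⟨Λ, -, -, b, hb⟩ := h
  have hbl : ∀ l : Λ, b l = expoLp μ l := fun l =>
    Lp.ext ((hb l).trans (coeFn_expoLp μ l).symm)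
  refine ⟨Λ, fun l hl l' hl' hne => ?_, fun f => ?_⟩
  · have := b.orthonormal.2 (i := ⟨l, hl⟩) (j := ⟨l', hl'⟩) fun e => hne (congrArg Subtype.val e)
    change inner ℂ (b _) (b _) = 0 at this
    rwa [hbl, hbl, inner_expoLp_expoLp] at this
  · have := b.hasSum_inner_mul_inner f f
    have h1 : ((‖f‖ ^ 2 : ℝ) : ℂ) = inner ℂ f f := by rw [inner_self_eq_norm_sq_to_K]; simp
    have h2 : ∀ l : Λ, inner ℂ f (b l) * inner ℂ (b l) f =
        ((‖inner ℂ (expoLp μ l) f‖ ^ 2 : ℝ) : ℂ) := fun l => by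
      rw [hbl, ← inner_conj_symm f, ← Complex.normSq_eq_conj_mul_self, Complex.normSq_eq_norm_sq]
    rw [← h1] at this
    simp only [h2] at this
    exact Complex.hasSum_ofReal.1 this

end L2

end Moran
namespace Moran

/-! ### Construction of a spectrum for even matrices -/

section Spectrum

variable {M : ℕ → Matrix (Fin 2) (Fin 2) ℤ} {D : ℕ → Finset (Fin 2 → ℤ)} {r C : ℝ} {q : ℕ}

lemma ft_neg (μ : Measure Plane) (ξ : Plane) : ft μ (-ξ) = (starRingEnd ℂ) (ft μ ξ) := by
  rw [ft, ft, ← integral_conj]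
  simp only [conj_expo]

lemma Admissible.ft_tail (h : Admissible M D r C q) {σ : ℕ → Measure Plane}
    (hσ : ∀ n, IsMoranMeasure (Moran.shift M n) (Moran.shift D n) (σ n)) (n : ℕ) (ξ : Plane) :
    ft (σ n) ξ = mask (D (n + 1)) (invT (M (n + 1)) ξ) *
      ft (σ (n + 1)) (invT (M (n + 1)) ξ) := by
  have h1 : ∀ {α : Type} (F : ℕ → α), Moran.shift (Moran.shift F n) 1 = Moran.shift F (n + 1) := by
    intro α F; funext k; simp only [Moran.shift]; congr 1; omega
  have hs := hσ (n + 1)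
  rw [← h1, ← h1] at hs
  rw [(h.shift n).ft_eq_partialProd_mul (hσ n) hs]
  simp [partialProd, freq_succ, Moran.shift, add_comm]

/-- The system starts with the tail after one step, so that its first matrix is `M 2` and `M 1` need
not be even. -/
lemma Admissible.tailSystem (h : Admissible M D r C q) (heven : ∀ n ≥ 2, IsGLTwoEven (M n))
    {σ : ℕ → Measure Plane}
    (hσ : ∀ n, IsMoranMeasure (Moran.shift M n) (Moran.shift D n) (σ n)) :
    TailSystem (fun n => M (n + 2)) (fun n => D (n + 2)) (fun n => ft (σ (n + 1))) r
      (2 * Real.pi * (C * (1 - r)⁻¹)) (2 * q) where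
  digit n := h.digit _ (by omega)
  finite := h.finite.subset (by rintro _ ⟨n, rfl⟩; exact ⟨n + 2, by omega, rfl⟩)
  even n := (heven _ (by omega)).2
  det n := h.det _ (by omega)
  norm_le n := h.norm_invT (by omega)
  r_nonneg := h.r_nonneg
  r_lt := h.r_lt
  Q_pos := by have := h.q_odd.pos; omega
  zeros n x hx := by
    obtain ⟨w, -, hw⟩ := h.zeros (n + 2) (by omega) x hx
    exact ⟨w, hw.symm⟩
  refine_eq n ξ := h.ft_tail hσ (n + 1) ξ
  zero_eq n := by
    have := (hσ (n + 1)).isProbabilityMeasure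
    exact ft_zero _
  L_nonneg := by
    have := h.C_nonneg
    have : 0 ≤ (1 - r)⁻¹ := inv_nonneg.2 (by linarith [h.r_lt])
    have := Real.pi_pos
    positivity
  lipschitz n ξ η := by
    have := (hσ (n + 1)).isProbabilityMeasure
    exact norm_ft_sub_le ((h.shift (n + 1)).ae_norm_le (hσ (n + 1))) ξ η

lemma Admissible.freq_cofreq_mem (h : Admissible M D r C q) {j n : ℕ} (hjn : j ≤ n) {x : Plane}
    (hx : x ∈ Set.range intVec) : freq M j (cofreq M n x) ∈ Set.range intVec := by
  induction n, hjn using Nat.le_induction generalizing x with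
  | base => rwa [h.freq_cofreq]
  | succ n _ ih =>
    obtain ⟨k, rfl⟩ := hx
    exact ih ⟨_, (actT_intVec _ _).symm⟩

/-- A half-integer correction at level `n + 1` is invisible to the masks of levels `1` to `n`. For
`n = 0` there are none, which is why evenness of `M 1` plays no role. -/
lemma Admissible.freq_cofreq_succ_mem (h : Admissible M D r C q)
    (heven : ∀ n ≥ 2, IsGLTwoEven (M n)) {j n : ℕ} (hj : 1 ≤ j) (hjn : j ≤ n) {x : Plane}
    (hx : (2 : ℝ) • x ∈ Set.range intVec) :
    freq M j (cofreq M (n + 1) x) ∈ Set.range intVec :=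
  h.freq_cofreq_mem hjn (actT_mem_of_even (heven (n + 1) (by omega)).2 hx)

/-- Given the digits `c n l v`, the `v`-th child of the frequency `l` of level `n`. -/
noncomputable def child (M : ℕ → Matrix (Fin 2) (Fin 2) ℤ) (c : ℕ → Plane → ℕ → Fin 2 → ℤ)
    (n : ℕ) (l : Plane) (v : ℕ) : Plane :=
  if v = 0 then l else l + cofreq M (n + 1) (halfVec v + intVec (c n l v))

/-- Enumeration of the frequencies of level `n` by the numbers below `4 ^ n`. -/
noncomputable def level (M : ℕ → Matrix (Fin 2) (Fin 2) ℤ) (c : ℕ → Plane → ℕ → Fin 2 → ℤ) :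
    ℕ → ℕ → Plane
  | 0 => fun _ => 0
  | n + 1 => fun k =>
    if k < 4 ^ n then level M c n k else child M c n (level M c n (k % 4 ^ n)) (k / 4 ^ n)

/-- Enumeration of all frequencies. -/
noncomputable def spectrumSeq (M : ℕ → Matrix (Fin 2) (Fin 2) ℤ)
    (c : ℕ → Plane → ℕ → Fin 2 → ℤ) (k : ℕ) : Plane := level M c k k

variable {c : ℕ → Plane → ℕ → Fin 2 → ℤ}

lemma level_eq_of_le {n m k : ℕ} (hk : k < 4 ^ n) (hnm : n ≤ m) :
    level M c m k = level M c n k := by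
  induction m, hnm using Nat.le_induction with
  | base => rfl
  | succ m hm ih =>
    rw [level]
    exact (if_pos (hk.trans_le (Nat.pow_le_pow_right (by norm_num) hm))).trans ih

lemma spectrumSeq_eq_level {n k : ℕ} (hk : k < 4 ^ n) : spectrumSeq M c k = level M c n k := by
  have hkk : k < 4 ^ k := Nat.lt_pow_self (by norm_num)
  rw [spectrumSeq]
  rcases le_total k n with h | h
  · exact (level_eq_of_le hkk h).symm
  · exact level_eq_of_le hk h

lemma spectrumSeq_add {n k v : ℕ} (hk : k < 4 ^ n) (hv : v < 4) :
    spectrumSeq M c (k + 4 ^ n * v) = child M c n (spectrumSeq M c k) v := by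
  have hpos : 0 < 4 ^ n := by positivity
  rcases Nat.eq_zero_or_pos v with rfl | hv0
  · simp [child]
  · have h1 : k + 4 ^ n * v < 4 ^ (n + 1) := by
      rw [pow_succ]
      have : 4 ^ n * v ≤ 4 ^ n * 3 := Nat.mul_le_mul_left _ (by omega)
      omega
    have h2 : ¬ k + 4 ^ n * v < 4 ^ n := by
      have : 4 ^ n * 1 ≤ 4 ^ n * v := Nat.mul_le_mul_left _ hv0
      omega
    rw [spectrumSeq_eq_level h1, level]
    beta_reduce
    rw [if_neg h2, Nat.add_mul_mod_self_left, Nat.mod_eq_of_lt hk,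
      Nat.add_mul_div_left _ _ hpos, Nat.div_eq_of_lt hk, zero_add, spectrumSeq_eq_level hk]

lemma Admissible.freq_child (h : Admissible M D r C q) (n v : ℕ) (l : Plane) :
    ∃ k, freq M (n + 1) (child M c n l v) = freq M (n + 1) l + halfVec v + intVec k ∧
      (v ≠ 0 → k = c n l v) := by
  by_cases hv : v = 0
  · exact ⟨0, by simp [child, hv], fun h => (h hv).elim⟩
  · refine ⟨c n l v, ?_, fun _ => rfl⟩
    rw [child, if_neg hv, map_add, h.freq_cofreq, add_assoc]

lemma Admissible.partialProd_child (h : Admissible M D r C q)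
    (heven : ∀ n ≥ 2, IsGLTwoEven (M n)) (n v : ℕ) (l ξ : Plane) :
    partialProd M D n (ξ + child M c n l v) = partialProd M D n (ξ + l) := by
  by_cases hv : v = 0
  · simp [child, hv]
  refine Finset.prod_congr rfl fun k hk => ?_
  obtain ⟨w, hw⟩ := h.freq_cofreq_succ_mem heven (j := k + 1) (n := n) (by omega)
    (by have := Finset.mem_range.1 hk; omega)
    (x := halfVec v + intVec (c n l v)) (by
      obtain ⟨a, ha⟩ := two_smul_halfVec v
      refine ⟨a + (2 : ℤ) • c n l v, ?_⟩
      rw [intVec_add, ha, intVec_smul, smul_add]; norm_num)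
  rw [child, if_neg hv, ← add_assoc, map_add (freq M (k + 1)) (ξ + l), ← hw, mask_add_intVec]

lemma sum_range_mul_eq {F : ℕ → ℝ} (a m : ℕ) : ∑ i ∈ Finset.range (a * m), F i =
    ∑ v ∈ Finset.range m, ∑ k ∈ Finset.range a, F (k + a * v) := by
  induction m with
  | zero => simp
  | succ m ih =>
    rw [Nat.mul_succ, Finset.sum_range_add, ih, Finset.sum_range_succ]
    simp only [add_comm]

/-- The four children of a frequency share its first `n` factors, and the squared moduli of their
last factors sum to one by `sum_sq_norm_mask`. -/
lemma Admissible.sum_sq_partialProd (h : Admissible M D r C q)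
    (heven : ∀ n ≥ 2, IsGLTwoEven (M n)) (n : ℕ) (ξ : Plane) :
    ∑ k ∈ Finset.range (4 ^ n), ‖partialProd M D n (ξ + spectrumSeq M c k)‖ ^ 2 = 1 := by
  induction n with
  | zero => simp [partialProd]
  | succ n ih =>
    rw [pow_succ, sum_range_mul_eq, Finset.sum_comm, ← ih]
    refine Finset.sum_congr rfl fun k hk => ?_
    have hk := Finset.mem_range.1 hk
    rw [← mul_one (‖partialProd M D n (ξ + spectrumSeq M c k)‖ ^ 2),
      ← sum_sq_norm_mask (h.digit (n + 1) (by omega)) (freq M (n + 1) (ξ + spectrumSeq M c k)),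
      Finset.mul_sum]
    refine Finset.sum_congr rfl fun v hv => ?_
    rw [spectrumSeq_add hk (Finset.mem_range.1 hv), partialProd, Finset.prod_range_succ,
      ← partialProd, h.partialProd_child heven, norm_mul, mul_pow]
    obtain ⟨w, hw, -⟩ := h.freq_child (c := c) n v (spectrumSeq M c k)
    rw [map_add, hw, ← add_assoc, mask_add_intVec, map_add, add_assoc]

lemma Admissible.partialProd_zero_arg (h : Admissible M D r C q) (n : ℕ) :
    partialProd M D n 0 = 1 := by
  rw [partialProd]
  refine Finset.prod_eq_one fun k _ => ?_
  rw [map_zero, mask_zero (h.digit _ (by omega))]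

lemma Admissible.ft_spectrumSeq_sub (h : Admissible M D r C q)
    (heven : ∀ n ≥ 2, IsGLTwoEven (M n)) {μ : Measure Plane} (hμ : IsMoranMeasure M D μ)
    {i j : ℕ} (hij : i ≠ j) : ft μ (spectrumSeq M c j - spectrumSeq M c i) = 0 := by
  obtain ⟨n, hi, hj⟩ : ∃ n, i < 4 ^ n ∧ j < 4 ^ n :=
    ⟨max i j, (le_max_left i j).trans_lt (Nat.lt_pow_self (by norm_num)),
      (le_max_right i j).trans_lt (Nat.lt_pow_self (by norm_num))⟩
  -- At minus the `i`-th frequency, the `i`-th term alone is already one, so all other terms vanish.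
  have hs := h.sum_sq_partialProd (c := c) heven n (-spectrumSeq M c i)
  rw [← Finset.add_sum_erase _ _ (Finset.mem_range.2 hi), neg_add_cancel, h.partialProd_zero_arg,
    norm_one, one_pow, add_eq_left] at hs
  have h0 := (Finset.sum_eq_zero_iff_of_nonneg fun _ _ => by positivity).1 hs j
    (Finset.mem_erase.2 ⟨hij.symm, Finset.mem_range.2 hj⟩)
  rw [sq_eq_zero_iff, norm_eq_zero, neg_add_eq_sub] at h0
  obtain ⟨σ, hσ⟩ := (h.shift n).exists_isMoranMeasure
  rw [h.ft_eq_partialProd_mul hμ hσ, h0, zero_mul]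

lemma Admissible.norm_partialProd_anti (h : Admissible M D r C q) {m n : ℕ} (hmn : m ≤ n)
    (ξ : Plane) : ‖partialProd M D n ξ‖ ≤ ‖partialProd M D m ξ‖ := by
  obtain ⟨k, rfl⟩ := Nat.exists_eq_add_of_le hmn
  rw [partialProd_add, norm_mul]
  exact mul_le_of_le_one_right (norm_nonneg _) ((h.shift m).norm_partialProd_le_one _ _)

lemma Admissible.tsum_spectrumSeq (h : Admissible M D r C q)
    (heven : ∀ n ≥ 2, IsGLTwoEven (M n)) {μ : Measure Plane} (hμ : IsMoranMeasure M D μ)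
    {σ : ℕ → Measure Plane}
    (hσ : ∀ n, IsMoranMeasure (Moran.shift M n) (Moran.shift D n) (σ n)) {ε : ℝ} (hε : 0 < ε)
    (hc : ∀ n l v, ε ≤ ‖ft (σ (n + 1)) (freq M (n + 1) l + halfVec v + intVec (c n l v))‖)
    (ξ : Plane) : ∑' k, ‖ft μ (ξ + spectrumSeq M c k)‖ ^ 2 = 1 := by
  -- The frequency with index `k ≥ 1` is born at level `Nat.log 4 k + 1`, as a child with nonzero
  -- `v`. Its integer part was chosen there, which gives the lower bound `hlow`.
  set L := 2 * Real.pi * (C * (1 - r)⁻¹) with hL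
  have hsys := h.tailSystem heven hσ
  have hlow : ∀ k, 1 ≤ k →
      ε ≤ ‖ft (σ (Nat.log 4 k + 1)) (freq M (Nat.log 4 k + 1) (spectrumSeq M c k))‖ := by
    intro k hk
    set n := Nat.log 4 k with hn
    have h1 : 4 ^ n ≤ k := Nat.pow_log_le_self 4 (by omega)
    have h2 : k < 4 ^ (n + 1) := Nat.lt_pow_succ_log_self (by norm_num) k
    have hpos : 0 < 4 ^ n := by positivity
    have hv : k / 4 ^ n < 4 := by
      rw [Nat.div_lt_iff_lt_mul hpos]; rw [pow_succ] at h2; omega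
    have hv0 : k / 4 ^ n ≠ 0 := (Nat.div_pos h1 hpos).ne'
    have hk' : k = k % 4 ^ n + 4 ^ n * (k / 4 ^ n) := (Nat.mod_add_div k (4 ^ n)).symm
    have hseq := spectrumSeq_add (M := M) (c := c) (Nat.mod_lt k hpos) hv
    rw [← hk'] at hseq
    obtain ⟨w, hw, hwc⟩ := h.freq_child (c := c) n (k / 4 ^ n) (spectrumSeq M c (k % 4 ^ n))
    rw [hseq, hw, hwc hv0]
    exact hc _ _ _
  have hlim : Tendsto (fun n => L * (r ^ n * ‖ξ‖)) atTop (𝓝 0) := by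
    have := ((tendsto_pow_atTop_nhds_zero_of_lt_one h.r_nonneg h.r_lt).mul_const ‖ξ‖).const_mul L
    simpa using this
  -- From level `m₀` on, the shift by `ξ` costs at most half of the lower bound `ε`. The finitely
  -- many earlier frequencies are dominated by the constant 1.
  obtain ⟨m₀, hm₀⟩ := eventually_atTop.1 (hlim.eventually (gt_mem_nhds (half_pos hε)))
  have hbound : ∀ k, 4 ^ m₀ ≤ k → ∀ n, k < 4 ^ n →
      ‖partialProd M D n (ξ + spectrumSeq M c k)‖ ^ 2 ≤
        (2 / ε) ^ 2 * ‖ft μ (ξ + spectrumSeq M c k)‖ ^ 2 := by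
    intro k hk n hkn
    have hpos : 0 < 4 ^ m₀ := by positivity
    have hlog : Nat.log 4 k < n := Nat.log_lt_of_lt_pow (by omega) hkn
    have hlog' : m₀ ≤ Nat.log 4 k := Nat.le_log_of_pow_le (by norm_num) hk
    have h1 := hlow k (by omega)
    set m := Nat.log 4 k + 1
    set x := ξ + spectrumSeq M c k with hx
    have h2 := hsys.lipschitz (Nat.log 4 k) (freq M m (spectrumSeq M c k)) (freq M m x)
    have h3 : L * ‖freq M m (spectrumSeq M c k) - freq M m x‖ ≤ ε / 2 := by
      rw [← map_sub, hx, sub_add_cancel_right, map_neg, norm_neg]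
      exact (mul_le_mul_of_nonneg_left (h.norm_freq m ξ) hsys.L_nonneg).trans
        (hm₀ m (by omega)).le
    have h4 := norm_sub_norm_le (ft (σ m) (freq M m (spectrumSeq M c k))) (ft (σ m) (freq M m x))
    have h5 : ε / 2 ≤ ‖ft (σ m) (freq M m x)‖ := by
      have : ‖ft (σ m) (freq M m (spectrumSeq M c k)) - ft (σ m) (freq M m x)‖ ≤ ε / 2 :=
        h2.trans h3
      linarith
    rw [← mul_pow]
    refine pow_le_pow_left₀ (norm_nonneg _) ?_ 2
    rw [h.ft_eq_partialProd_mul hμ (hσ m), norm_mul]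
    have h6 := h.norm_partialProd_anti (show m ≤ n by omega) x
    have h7 : ‖partialProd M D m x‖ * (ε / 2) ≤
        ‖partialProd M D m x‖ * ‖ft (σ m) (freq M m x)‖ := by gcongr
    calc ‖partialProd M D n x‖ ≤ ‖partialProd M D m x‖ := h6
      _ = 2 / ε * (‖partialProd M D m x‖ * (ε / 2)) := by field_simp
      _ ≤ _ := by gcongr
  set f : ℕ → ℕ → ℝ := fun n k =>
    if k < 4 ^ n then ‖partialProd M D n (ξ + spectrumSeq M c k)‖ ^ 2 else 0 with hf
  have hf0 : ∀ n k, 0 ≤ f n k := fun n k => by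
    simp only [hf]; split_ifs <;> positivity
  have hfsum : ∀ n, ∑' k, f n k = 1 := by
    intro n
    rw [tsum_eq_sum (s := Finset.range (4 ^ n)), ← h.sum_sq_partialProd (c := c) heven n ξ]
    · exact Finset.sum_congr rfl fun k hk => if_pos (Finset.mem_range.1 hk)
    · intro k hk
      exact if_neg fun h => hk (Finset.mem_range.2 h)
  have hfs : ∀ n (s : Finset ℕ), ∑ k ∈ s, f n k ≤ 1 := by
    intro n s
    rw [← hfsum n]
    refine Summable.sum_le_tsum s (fun k _ => hf0 n k) ?_
    exact summable_of_ne_finset_zero (s := Finset.range (4 ^ n)) fun k hk =>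
      if_neg fun h => hk (Finset.mem_range.2 h)
  have hft : ∀ k, Tendsto (fun n => f n k) atTop (𝓝 (‖ft μ (ξ + spectrumSeq M c k)‖ ^ 2)) := by
    intro k
    refine ((h.tendsto_partialProd hμ (ξ + spectrumSeq M c k)).norm.pow 2).congr' ?_
    filter_upwards [eventually_ge_atTop k] with n hn
    have : k < 4 ^ n := hn.trans_lt (Nat.lt_pow_self (by norm_num))
    simp only [hf, if_pos this]
  have hsumm : Summable fun k => ‖ft μ (ξ + spectrumSeq M c k)‖ ^ 2 :=
    summable_of_sum_le (fun k => by positivity) fun s =>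
      le_of_tendsto (tendsto_finsetSum s fun k _ => hft k)
        (Eventually.of_forall fun n => hfs n s)
  have hdom := tendsto_tsum_of_dominated_convergence (f := f) (𝓕 := atTop)
    (bound := fun k => (if k < 4 ^ m₀ then 1 else 0) +
      (2 / ε) ^ 2 * ‖ft μ (ξ + spectrumSeq M c k)‖ ^ 2) ?_ hft ?_
  · simp only [hfsum] at hdom
    exact tendsto_nhds_unique hdom tendsto_const_nhds
  · refine Summable.add ?_ (hsumm.mul_left _)
    exact summable_of_ne_finset_zero (s := Finset.range (4 ^ m₀)) fun k hk =>
      if_neg fun h => hk (Finset.mem_range.2 h)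
  · refine Eventually.of_forall fun n k => ?_
    rw [Real.norm_eq_abs, abs_of_nonneg (hf0 n k)]
    simp only [hf]
    by_cases hkn : k < 4 ^ n
    · rw [if_pos hkn]
      by_cases hkm : k < 4 ^ m₀
      · rw [if_pos hkm]
        have : ‖partialProd M D n (ξ + spectrumSeq M c k)‖ ^ 2 ≤ 1 :=
          pow_le_one₀ (norm_nonneg _) (h.norm_partialProd_le_one _ _)
        have : 0 ≤ (2 / ε) ^ 2 * ‖ft μ (ξ + spectrumSeq M c k)‖ ^ 2 := by positivity
        linarith
      · rw [if_neg hkm, zero_add]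
        exact hbound k (not_lt.1 hkm) n hkn
    · rw [if_neg hkn]
      split_ifs <;> positivity

/-- If `Mₙ` is even for `n ≥ 2`, then the Moran measure is spectral. -/
theorem Admissible.isSpectral (h : Admissible M D r C q) (heven : ∀ n ≥ 2, IsGLTwoEven (M n))
    {μ : Measure Plane} (hμ : IsMoranMeasure M D μ) : IsSpectral μ := by
  have := hμ.isProbabilityMeasure
  choose σ hσ using fun n => (h.shift n).exists_isMoranMeasure
  obtain ⟨ε, hε, hlow⟩ := (h.tailSystem heven hσ).exists_uniform_lower_bound
  choose c hc using fun (n : ℕ) (l : Plane) (v : ℕ) => hlow n (freq M (n + 1) l + halfVec v)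
  have horth : ∀ i j, i ≠ j → ft μ (spectrumSeq M c j - spectrumSeq M c i) = 0 :=
    fun i j hij => h.ft_spectrumSeq_sub heven hμ hij
  have hinj : Function.Injective (spectrumSeq M c) := by
    intro i j e
    by_contra hij
    have := horth i j hij
    rw [e, sub_self, ft_zero] at this
    exact one_ne_zero this
  refine isSpectral_of_parseval (Set.countable_range (spectrumSeq M c)) ?_ fun ξ => ?_
  · rintro _ ⟨i, rfl⟩ _ ⟨j, rfl⟩ hne
    exact horth i j fun e => hne (by rw [e])
  · rw [tsum_range (fun l => ‖ft μ (ξ - l)‖ ^ 2) hinj,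
      ← h.tsum_spectrumSeq heven hμ hσ hε hc (-ξ)]
    refine le_of_eq (tsum_congr fun k => ?_)
    rw [← neg_sub, neg_add_eq_sub, neg_sub, ← neg_sub (spectrumSeq M c k), ft_neg, RCLike.norm_conj]

end Spectrum

end Moran
namespace Moran

/-! ### Slabs cut off by a linear functional -/

section Slab

/-- Among the directions `(1, t)`, each nonzero vector excludes at most one `t`. -/
lemma exists_inner_ne_zero {X : Set Plane} (hX : X.Countable) :
    ∃ u : Plane, ∀ x ∈ X, x ≠ 0 → inner ℝ u x ≠ 0 := by
  have hc : ((fun x : Plane => -x 0 / x 1) '' X).Countable := hX.image _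
  obtain ⟨t, ht⟩ : ∃ t, t ∉ (fun x : Plane => -x 0 / x 1) '' X := by
    by_contra! hall
    exact Cardinal.not_countable_real (hc.mono fun t _ => hall t)
  refine ⟨!₂[1, t], fun x hx hx0 he => ?_⟩
  have he' : x 0 + t * x 1 = 0 := by simpa [inner_plane] using he
  by_cases h1 : x 1 = 0
  · refine hx0 ?_
    ext i
    fin_cases i
    · simpa [h1] using he'
    · simpa using h1
  · refine ht ⟨x, hx, ?_⟩
    simp only
    rw [div_eq_iff h1]; linarith

/-- The measure `ν` has an atom at `p`, and apart from it lives at depth `ε` below `p` in the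
direction `u`. -/
def IsTopAtom (ν : Measure Plane) (u p : Plane) (ε : ℝ) : Prop :=
  ∀ᵐ x ∂ν, x = p ∨ inner ℝ u x ≤ inner ℝ u p - ε

variable {ν ν' τ : Measure Plane} {u p p' : Plane} {ε ε' : ℝ}

lemma IsTopAtom.mono (h : IsTopAtom ν u p ε) (hε : ε' ≤ ε) : IsTopAtom ν u p ε' := by
  filter_upwards [h] with x hx
  exact hx.imp_right fun h => by linarith

lemma measurableSet_inner_gt (u : Plane) (a : ℝ) : MeasurableSet {x : Plane | a < inner ℝ u x} :=
  measurableSet_lt measurable_const (by fun_prop)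

lemma measurableSet_top (u p : Plane) (a : ℝ) :
    MeasurableSet {x : Plane | x = p ∨ inner ℝ u x ≤ a} :=
  (measurableSet_singleton p).union
    (measurableSet_le (f := fun x : Plane => (inner ℝ u x : ℝ)) (by fun_prop) measurable_const)

lemma ae_prod_of_ae [SFinite ν] [SFinite ν'] {P Q : Plane → Prop} (h : ∀ᵐ x ∂ν, P x)
    (h' : ∀ᵐ x ∂ν', Q x) : ∀ᵐ z ∂(ν.prod ν'), P z.1 ∧ Q z.2 :=
  (Measure.quasiMeasurePreserving_fst.ae h).and (Measure.quasiMeasurePreserving_snd.ae h')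

lemma IsTopAtom.conv [SFinite ν] [SFinite ν'] (h : IsTopAtom ν u p ε) (h' : IsTopAtom ν' u p' ε)
    (hε : 0 ≤ ε) : IsTopAtom (Measure.conv ν ν') u (p + p') ε := by
  rw [IsTopAtom, Measure.conv, ae_map_iff (by fun_prop) (measurableSet_top u _ _)]
  filter_upwards [ae_prod_of_ae h h'] with z hz
  rw [inner_add_right, inner_add_right]
  rcases hz with ⟨h1 | h1, h2 | h2⟩
  · exact Or.inl (by rw [h1, h2])
  · exact Or.inr (by rw [h1]; linarith)
  · exact Or.inr (by rw [h2]; linarith)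
  · exact Or.inr (by linarith)

lemma IsTopAtom.conv_singleton [SFinite ν] [SFinite ν'] (h : IsTopAtom ν u p ε)
    (h' : IsTopAtom ν' u p' ε) (hε : 0 < ε) :
    Measure.conv ν ν' {p + p'} = ν {p} * ν' {p'} := by
  rw [Measure.conv, Measure.map_apply (by fun_prop) (measurableSet_singleton _),
    ← Measure.prod_prod]
  refine measure_congr ?_
  filter_upwards [ae_prod_of_ae h h'] with z hz
  refine propext ⟨fun he => ?_, fun he => ?_⟩
  · have he : z.1 + z.2 = p + p' := he
    have he2 := congrArg (fun x => (inner ℝ u x : ℝ)) he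
    simp only [inner_add_right] at he2
    rcases hz with ⟨h1 | h1, h2 | h2⟩
    · exact ⟨h1, h2⟩
    · rw [h1] at he2; linarith
    · rw [h2] at he2; linarith
    · linarith
  · change z.1 + z.2 = p + p'
    rw [show z.1 = p from he.1, show z.2 = p' from he.2]

variable {M : ℕ → Matrix (Fin 2) (Fin 2) ℤ} {D : ℕ → Finset (Fin 2 → ℤ)} {r C : ℝ} {q : ℕ}

lemma exists_isTopAtom_sum_dirac {X : Finset Plane} (hX : X.Nonempty)
    (hu : Set.InjOn (fun x => (inner ℝ u x : ℝ)) (X : Set Plane)) :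
    ∃ p ε, 0 < ε ∧ IsTopAtom (∑ x ∈ X, Measure.dirac x) u p ε ∧
      (∑ x ∈ X, Measure.dirac x) {p} = 1 := by
  classical
  obtain ⟨p, hp, hmax⟩ := X.exists_max_image (fun x => (inner ℝ u x : ℝ)) hX
  have hgap : ∃ ε > 0, ∀ x ∈ X.erase p, (inner ℝ u x : ℝ) ≤ inner ℝ u p - ε := by
    rcases (X.erase p).eq_empty_or_nonempty with he | hne
    · exact ⟨1, one_pos, by simp [he]⟩
    · obtain ⟨y, hy, hymax⟩ := (X.erase p).exists_max_image (fun x => (inner ℝ u x : ℝ)) hne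
      obtain ⟨hyp, hyX⟩ := Finset.mem_erase.1 hy
      have hlt : (inner ℝ u y : ℝ) < inner ℝ u p :=
        lt_of_le_of_ne (hmax y hyX) fun he => hyp (hu hyX hp he)
      exact ⟨inner ℝ u p - inner ℝ u y, by linarith, fun x hx => by
        have := hymax x hx
        linarith⟩
  obtain ⟨ε, hε, hgap⟩ := hgap
  refine ⟨p, ε, hε, ?_, ?_⟩
  · rw [IsTopAtom, ae_iff, Measure.finsetSum_apply]
    refine Finset.sum_eq_zero fun x hx => ?_
    rw [← ae_iff, ae_dirac_iff (measurableSet_top u _ _)]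
    by_cases hxp : x = p
    · exact Or.inl hxp
    · exact Or.inr (hgap x (Finset.mem_erase.2 ⟨hxp, hx⟩))
  · rw [Measure.finsetSum_apply, Finset.sum_eq_single p]
    · simp
    · intro x _ hxp
      simp [hxp]
    · exact fun h => (h hp).elim

/-- A direction avoiding the countably many differences of scaled digits gives each convolution
factor a unique top point, of mass `1 / 4`; top atoms add, and their masses multiply. -/
lemma Admissible.exists_isTopAtom (h : Admissible M D r C q) :
    ∃ u : Plane, ∀ n, ∃ p ε, 0 < ε ∧ IsTopAtom (partialMoran M D n) u p ε ∧
      partialMoran M D n {p} = (4 ^ n : ℝ≥0∞)⁻¹ := by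
  obtain ⟨u, hu⟩ := exists_inner_ne_zero (X := Set.range fun z : ℕ × (Fin 2 → ℤ) =>
    act (invProd M z.1) (intVec z.2)) (Set.countable_range _)
  refine ⟨u, fun n => ?_⟩
  induction n with
  | zero =>
    refine ⟨0, 1, one_pos, ?_, by simp [partialMoran]⟩
    rw [partialMoran, IsTopAtom, ae_dirac_iff (measurableSet_top u _ _)]
    exact Or.inl rfl
  | succ n ih =>
    obtain ⟨p, ε, hε, hp, hm⟩ := ih
    have := h.isProbabilityMeasure_partialMoran n
    have := h.isProbabilityMeasure_discreteMeasure (n := n + 1) (by omega)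
    have hinj : Function.Injective fun d => act (invProd M (n + 1)) (intVec d) :=
      (h.act_invProd_injective (n + 1)).comp intVec_injective
    obtain ⟨p', ε', hε', hp', hm'⟩ := exists_isTopAtom_sum_dirac (u := u)
      (X := (D (n + 1)).image fun d => act (invProd M (n + 1)) (intVec d))
      (by rw [Finset.image_nonempty, ← Finset.card_pos, (h.digit _ (by omega)).card_eq]; norm_num)
      (by
        intro x hx y hy he
        obtain ⟨d, -, rfl⟩ := Finset.mem_image.1 hx
        obtain ⟨e, -, rfl⟩ := Finset.mem_image.1 hy
        by_contra hne
        refine hu (act (invProd M (n + 1)) (intVec (d - e))) ⟨(n + 1, d - e), rfl⟩ ?_ ?_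
        · rw [intVec_sub, map_sub]; exact sub_ne_zero.2 hne
        · rw [intVec_sub, map_sub, inner_sub_right]; exact sub_eq_zero.2 he)
    rw [Finset.sum_image fun x _ y _ e => hinj e] at hp' hm'
    have hp2 : IsTopAtom (discreteMeasure ((D (n + 1)).image (applyInt (invProd M (n + 1)))))
        u p' ε' := by
      rw [h.discreteMeasure_eq (by omega)]
      exact Measure.ae_smul_measure hp' _
    have ha := hp.mono (min_le_left ε ε')
    have hb := hp2.mono (min_le_right ε ε')
    have hpos : 0 < min ε ε' := lt_min hε hε'
    refine ⟨p + p', min ε ε', hpos, ha.conv hb hpos.le, ?_⟩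
    rw [partialMoran, ha.conv_singleton hb hpos, hm, h.discreteMeasure_eq (by omega),
      Measure.smul_apply, hm', smul_eq_mul, mul_one, pow_succ,
      ENNReal.mul_inv (Or.inr (by norm_num)) (Or.inr (by norm_num))]

/-- Otherwise every essential upper bound could be lowered by `ε`, indefinitely, against boundedness
of the support. -/
lemma exists_slab [IsProbabilityMeasure τ] {K : ℝ} (hτ : ∀ᵐ x ∂τ, ‖x‖ ≤ K) (u : Plane)
    (hε : 0 < ε) :
    ∃ c, (∀ᵐ x ∂τ, (inner ℝ u x : ℝ) ≤ c) ∧ τ {x | c - ε < inner ℝ u x} ≠ 0 := by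
  by_contra! hcon
  have hall : ∀ n : ℕ, ∀ᵐ x ∂τ, (inner ℝ u x : ℝ) ≤ ‖u‖ * K - n * ε := by
    intro n
    induction n with
    | zero =>
      filter_upwards [hτ] with x hx
      have := real_inner_le_norm u x
      have : ‖u‖ * ‖x‖ ≤ ‖u‖ * K := by gcongr
      simp; linarith
    | succ n ih =>
      have := hcon _ ih
      rw [← compl_compl {x | _ < _}, ← mem_ae_iff] at this
      filter_upwards [this] with x hx
      have : inner ℝ u x ≤ ‖u‖ * K - n * ε - ε := not_lt.1 hx
      push_cast; linarith
  obtain ⟨n, hn⟩ := exists_nat_gt ((2 * (‖u‖ * K)) / ε)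
  rw [div_lt_iff₀ hε] at hn
  obtain ⟨x, hx, hxK⟩ := ((hall n).and hτ).exists
  have h1 := neg_le_of_abs_le (abs_real_inner_le_norm u x)
  have : ‖u‖ * ‖x‖ ≤ ‖u‖ * K := by gcongr
  linarith

/-- Points of `ν` other than `p` lie `ε` lower, so their sums with points of `τ` do not reach the
slab: there `ν ∗ τ` is a translated and scaled copy of `τ`. -/
lemma IsTopAtom.setIntegral_conv [IsProbabilityMeasure ν] [IsProbabilityMeasure τ]
    (h : IsTopAtom ν u p ε) {c : ℝ} (hc : ∀ᵐ x ∂τ, (inner ℝ u x : ℝ) ≤ c) {F : Plane → ℂ}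
    (hF : Continuous F) {B : ℝ} (hB : ∀ x, ‖F x‖ ≤ B) :
    ∫ x in {x | inner ℝ u p + c - ε < inner ℝ u x}, F x ∂(Measure.conv ν τ) =
      ν.real {p} * ∫ y in {y | c - ε < inner ℝ u y}, F (p + y) ∂τ := by
  set S' := {x : Plane | inner ℝ u p + c - ε < inner ℝ u x} with hS'
  set S := {y : Plane | c - ε < inner ℝ u y} with hS
  have hmS' : MeasurableSet S' := measurableSet_inner_gt u _
  have hmS : MeasurableSet S := measurableSet_inner_gt u _
  have hint : Integrable (S'.indicator F) (Measure.conv ν τ) :=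
    ((integrable_const (c := B) (μ := Measure.conv ν τ)).mono' hF.aestronglyMeasurable
      (Eventually.of_forall hB)).indicator hmS'
  rw [← integral_indicator hmS', ← integral_indicator hmS, integral_conv hint]
  have key : (fun x => ∫ y, S'.indicator F (x + y) ∂τ) =ᵐ[ν]
      ({p} : Set Plane).indicator fun _ => ∫ y, S.indicator (fun y => F (p + y)) y ∂τ := by
    filter_upwards [h] with x hx
    by_cases hxp : x = p
    · rw [hxp, Set.indicator_of_mem (Set.mem_singleton p)]
      refine integral_congr_ae (Eventually.of_forall fun y => ?_)
      have hiff : p + y ∈ S' ↔ y ∈ S := by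
        simp only [hS', hS, Set.mem_ofPred_eq, inner_add_right]
        constructor <;> intro _ <;> linarith
      by_cases hy : y ∈ S
      · simp only [Set.indicator_of_mem hy, Set.indicator_of_mem (hiff.2 hy)]
      · simp only [Set.indicator_of_notMem hy, Set.indicator_of_notMem (mt hiff.1 hy)]
    · rw [Set.indicator_of_notMem (by simpa using hxp)]
      refine integral_eq_zero_of_ae ?_
      filter_upwards [hc] with y hy
      refine Set.indicator_of_notMem (fun hmem => ?_) _
      have hmem : inner ℝ u p + c - ε < inner ℝ u (x + y) := hmem
      rw [inner_add_right] at hmem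
      have := hx.resolve_left hxp
      linarith
  rw [integral_congr_ae key, integral_indicator (measurableSet_singleton p), setIntegral_const,
    Complex.real_smul]

lemma inner_expoLp_indicator (μ : Measure Plane) [IsProbabilityMeasure μ] {S : Set Plane}
    (hS : MeasurableSet S) (ξ : Plane) :
    inner ℂ (expoLp μ ξ) (indicatorConstLp 2 hS (measure_ne_top μ S) (1 : ℂ)) =
      ∫ x in S, expo (-ξ) x ∂μ := by
  rw [inner_expoLp_left, ← integral_indicator hS]
  refine integral_congr_ae ?_
  filter_upwards [indicatorConstLp_coeFn (p := 2) (hs := hS) (hμs := measure_ne_top μ S)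
    (c := (1 : ℂ))] with x hx
  rw [hx]
  by_cases h : x ∈ S <;> simp [h]

lemma norm_sq_indicator (μ : Measure Plane) [IsProbabilityMeasure μ] {S : Set Plane}
    (hS : MeasurableSet S) :
    ‖indicatorConstLp 2 hS (measure_ne_top μ S) (1 : ℂ)‖ ^ 2 = μ.real S := by
  rw [norm_indicatorConstLp (by norm_num) (by norm_num), norm_one, one_mul, ← Real.rpow_natCast,
    ← Real.rpow_mul measureReal_nonneg]
  norm_num

/-- Bessel's inequality for a family of exponentials that splits into finitely many orthonormal
families. -/
lemma sum_sq_inner_expoLp_le [IsProbabilityMeasure τ] {Λ : Set Plane} {κ : Type*} [Fintype κ]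
    (col : Plane → κ)
    (hcol : ∀ l ∈ Λ, ∀ l' ∈ Λ, l ≠ l' → col l = col l' → ft τ (l' - l) = 0)
    (f : Lp ℂ 2 τ) (s : Finset Λ) :
    ∑ l ∈ s, ‖(inner ℂ (expoLp τ (l : Plane)) f : ℂ)‖ ^ 2 ≤ Fintype.card κ * ‖f‖ ^ 2 := by
  classical
  rw [← Finset.sum_fiberwise s (fun l : Λ => col l)]
  calc _ ≤ ∑ _a : κ, ‖f‖ ^ 2 := Finset.sum_le_sum fun a _ => ?_
    _ = _ := by simp
  rw [← Finset.sum_subtype_eq_sum_filter]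
  have ho := orthonormal_expoLp τ (l := fun l : {l : Λ // col l = a} => ((l : Λ) : Plane))
    fun i j hij => hcol _ i.1.2 _ j.1.2 (fun e => hij (Subtype.ext (Subtype.ext e)))
      (i.2.trans j.2.symm)
  exact ho.sum_inner_products_le f

/-- If `ν ∗ τ` is spectral and the frequencies that `τ` does not separate can be coloured away,
then the number of colours is at least the reciprocal of the mass of a top atom of `ν`. -/
lemma IsSpectral.one_le_card_mul [IsProbabilityMeasure ν] [IsProbabilityMeasure τ]
    (hs : IsSpectral (Measure.conv ν τ)) (h : IsTopAtom ν u p ε) (hε : 0 < ε)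
    (hp : ν {p} ≠ 0) {K : ℝ} (hτ : ∀ᵐ x ∂τ, ‖x‖ ≤ K) {κ : Type*} [Fintype κ] (col : Plane → κ)
    (hcol : ∀ l l', ft ν (l' - l) = 0 → col l ≠ col l') :
    1 ≤ Fintype.card κ * ν.real {p} := by
  obtain ⟨Λ, horth, hpars⟩ := hs.exists_parseval
  obtain ⟨c, hc, hcpos⟩ := exists_slab hτ u hε
  set S' := {x : Plane | inner ℝ u p + c - ε < inner ℝ u x} with hS'
  set S := {y : Plane | c - ε < inner ℝ u y} with hS
  have hmS' : MeasurableSet S' := measurableSet_inner_gt u _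
  have hmS : MeasurableSet S := measurableSet_inner_gt u _
  have hm : 0 < ν.real {p} := ENNReal.toReal_pos hp (measure_ne_top _ _)
  have hSpos : 0 < τ.real S := ENNReal.toReal_pos hcpos (measure_ne_top _ _)
  have hmass : (Measure.conv ν τ).real S' = ν.real {p} * τ.real S := by
    have := h.setIntegral_conv hc (F := fun _ => 1) continuous_const (B := 1) (by simp)
    simp only [setIntegral_const, Complex.real_smul, mul_one] at this
    exact_mod_cast this
  have hcoef : ∀ l : Plane, ‖(inner ℂ (expoLp (Measure.conv ν τ) l)
      (indicatorConstLp 2 hmS' (measure_ne_top _ S') (1 : ℂ)) : ℂ)‖ ^ 2 =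
      ν.real {p} ^ 2 * ‖(inner ℂ (expoLp τ l)
        (indicatorConstLp 2 hmS (measure_ne_top _ S) (1 : ℂ)) : ℂ)‖ ^ 2 := by
    intro l
    rw [inner_expoLp_indicator, inner_expoLp_indicator,
      h.setIntegral_conv hc (continuous_expo (-l)) (B := 1) fun x => (norm_expo _ _).le]
    simp only [expo_add_right]
    rw [integral_const_mul, norm_mul, norm_mul, norm_expo, one_mul, mul_pow, Complex.norm_real,
      Real.norm_of_nonneg hm.le]
  have hsum := hpars (indicatorConstLp 2 hmS' (measure_ne_top _ S') (1 : ℂ))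
  rw [norm_sq_indicator, hmass] at hsum
  simp only [hcoef] at hsum
  -- The left side is Parseval for `ν ∗ τ`; the right side is Bessel for `τ` in each colour class.
  -- The mass of `p` enters linearly on one side and squared on the other.
  have hle : ν.real {p} * τ.real S ≤ ν.real {p} ^ 2 * (Fintype.card κ * τ.real S) := by
    refine hasSum_le_of_sum_le hsum fun s => ?_
    rw [← Finset.mul_sum, ← norm_sq_indicator τ hmS]
    gcongr
    refine sum_sq_inner_expoLp_le col (fun l hl l' hl' hne heq => ?_) _ s
    have h0 := horth l hl l' hl' hne
    rw [ft_conv] at h0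
    exact (mul_eq_zero.1 h0).resolve_left fun h0 => hcol l l' h0 heq
  have hpos : 0 < ν.real {p} * τ.real S := mul_pos hm hSpos
  refine le_of_mul_le_mul_right ?_ hpos
  linarith

end Slab

/-! ### Necessity of even entries -/

section Necessity

variable {M : ℕ → Matrix (Fin 2) (Fin 2) ℤ} {D : ℕ → Finset (Fin 2 → ℤ)} {r C : ℝ} {q : ℕ}

/-- Floors allow arbitrary real frequencies to be coloured, although only integral differences
matter. -/
lemma even_of_floor_eq {x y : ℝ} {k : ℤ} (h : ((⌊x⌋ : ℤ) : ZMod 2) = (⌊y⌋ : ℤ)) (hk : y - x = k) :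
    Even k := by
  rw [show y = x + k by linarith, Int.floor_add_intCast, Int.cast_add, left_eq_add] at h
  rwa [← ZMod.intCast_eq_zero_iff_even]

/-- The parities of the integer parts of `2 q` times a vector. -/
noncomputable def parity (q : ℕ) (x : Plane) (i : Fin 2) : ZMod 2 :=
  ((⌊((2 * q : ℕ) : ℝ) * x i⌋ : ℤ) : ZMod 2)

lemma even_of_parity_eq {x y : Plane} {w : Fin 2 → ℤ} {i : Fin 2}
    (h : parity q x i = parity q y i) (hw : ((2 * q : ℕ) : ℝ) • (y - x) = intVec w) :
    Even (w i) := by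
  refine even_of_floor_eq h ?_
  rw [← mul_sub, ← intVec_apply, ← hw]
  simp

theorem Admissible.isGLTwoEven_of_isSpectral (h : Admissible M D r C q) {μ : Measure Plane}
    (hμ : IsMoranMeasure M D μ) (hs : IsSpectral μ) {n : ℕ} (hn : 2 ≤ n) : IsGLTwoEven (M n) := by
  obtain ⟨m, rfl⟩ : ∃ m, n = m + 2 := ⟨n - 2, by omega⟩
  refine ⟨h.det_ne_zero (by omega), ?_⟩
  by_contra! hodd
  obtain ⟨a, b, hab⟩ := hodd
  obtain ⟨σ, hσ⟩ := (h.shift (m + 2)).exists_isMoranMeasure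
  have := hσ.isProbabilityMeasure
  have := h.isProbabilityMeasure_partialMoran (m + 2)
  have : IsProbabilityMeasure (σ.map (act (invProd M (m + 2)))) :=
    Measure.isProbabilityMeasure_map (act (invProd M (m + 2))).continuous.aemeasurable
  have hτ : ∀ᵐ x ∂σ.map (act (invProd M (m + 2))), ‖x‖ ≤ r ^ (m + 2) * (C * (1 - r)⁻¹) := by
    rw [ae_map_iff (act (invProd M (m + 2))).continuous.aemeasurable
      (measurableSet_le measurable_norm measurable_const)]
    filter_upwards [(h.shift (m + 2)).ae_norm_le hσ] with x hx
    have := h.r_nonneg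
    exact (h.norm_act_invProd _ x).trans (by gcongr)
  obtain ⟨u, hu⟩ := h.exists_isTopAtom
  obtain ⟨p, ε, hε, hp, hm⟩ := hu (m + 2)
  rw [h.eq_conv hμ hσ] at hs
  obtain ⟨i, hia⟩ : ∃ i : Fin 2, i ≠ a := exists_ne a
  -- Both parities at levels `1` to `m + 1`, but only the `i`-th at level `m + 2`: this makes `2 * 4
  -- ^ (m + 1)` colours, against an atom of mass `4⁻¹ ^ (m + 2)`.
  have key := hs.one_le_card_mul hp hε (by simp [hm]) hτ
    (fun l => ((fun k : Fin (m + 1) => parity q (freq M (k + 1) l),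
      parity q (freq M (m + 2) l) i) : (Fin (m + 1) → Fin 2 → ZMod 2) × ZMod 2)) (by
    intro l l' h0 heq
    rw [h.ft_partialMoran, partialProd, Finset.prod_eq_zero_iff] at h0
    obtain ⟨k, hk, h0⟩ := h0
    obtain ⟨h1, h2⟩ := Prod.mk.inj heq
    have hpar : ∀ k < m + 1, parity q (freq M (k + 1) l) = parity q (freq M (k + 1) l') :=
      fun k hk => congrFun h1 ⟨k, hk⟩
    obtain ⟨w, ⟨j, hj⟩, hw⟩ := h.zeros _ (by omega) _ h0
    rw [map_sub] at hw
    rw [← Int.not_even_iff_odd] at hj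
    rcases (Nat.lt_succ_iff_lt_or_eq.1 (Finset.mem_range.1 hk)) with hk | rfl
    · exact hj (even_of_parity_eq (congrFun (hpar k hk) j) hw)
    · have hwi := even_of_parity_eq h2 hw
      -- The missing parity is recovered from the level before: the `b`-th coordinate of `Mᵀ w` is
      -- even there, `w i` is even, and the coefficient `M a b` of `w a` is odd. Such a previous
      -- level exists because `n ≥ 2`.
      have hw2 : ((2 * q : ℕ) : ℝ) • (freq M (m + 1) l' - freq M (m + 1) l) =
          intVec ((M (m + 2)).transpose.mulVec w) := by
        rw [← actT_intVec, ← hw, ← map_sub, ← map_sub, map_smul, freq_succ M (m + 1),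
          actT_invT (h.det_ne_zero (n := m + 2) (by omega))]
      have hb := even_of_parity_eq (congrFun (hpar m (by omega)) b) hw2
      have hwa : Even (w a) := by
        have hexp : (M (m + 2)).transpose.mulVec w b = M (m + 2) a b * w a +
            M (m + 2) i b * w i := by
          simp only [Matrix.mulVec, dotProduct, Matrix.transpose_apply, Fin.sum_univ_two]
          fin_cases a <;> fin_cases i <;> simp at hia ⊢ <;> ring
        rw [hexp, Int.even_add, iff_true_right (hwi.mul_left _), Int.even_mul] at hb
        exact hb.resolve_left fun he => hab he.two_dvd
      refine hj ?_
      by_cases hja : j = a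
      · rwa [hja]
      · rwa [show j = i by omega])
  rw [measureReal_def, hm] at key
  simp only [Fintype.card_prod, Fintype.card_fun, ZMod.card, Fintype.card_fin,
    ENNReal.toReal_inv, ENNReal.toReal_pow, ENNReal.toReal_ofNat] at key
  rw [← div_eq_mul_inv, le_div_iff₀ (by positivity)] at key
  norm_num [pow_succ] at key

end Necessity

end Moran
theorem mainTheorem1
    (M : ℕ → Matrix (Fin 2) (Fin 2) ℤ) (D : ℕ → Finset (Fin 2 → ℤ))
    (hexp : ∀ n ≥ 1, Moran.IsExpanding (M n))
    (hdigit : ∀ n ≥ 1, Moran.IsDigitSet (D n))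
    (hdet : ∀ n ≥ 1, 4 < |(M n).det|)
    (hnorm : (⨆ n ≥ 1, Moran.opENorm (Moran.toReal (M n))⁻¹) < 1)
    (hfin : {E : Finset (Fin 2 → ℤ) | ∃ n ≥ 1, E = D n}.Finite) :
    (∃ μ : Measure Moran.Plane, Moran.IsMoranMeasure M D μ) ∧
      ∀ μ : Measure Moran.Plane, Moran.IsMoranMeasure M D μ →
        (Moran.IsSpectral μ ↔ ∀ n ≥ 2, Moran.IsGLTwoEven (M n)) := by
  obtain ⟨r, C, q, h⟩ := Moran.exists_admissible hdigit hdet hnorm hfin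
  exact ⟨h.exists_isMoranMeasure, fun μ hμ =>
    ⟨fun hs n hn => h.isGLTwoEven_of_isSpectral hμ hs hn, fun he => h.isSpectral he hμ⟩⟩
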